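/- **Setting.** Let $X$ be a finite domain and $g:X^*\to\mathbb R$. A real $z$ is *$\alpha$-accurate* for $y\in\mathbb R$, written $z\in(1\pm\alpha)\cdot y$, if $|z-y|\le\alpha|y|$. The *space* of an algorithm is the number of bits needed to store its memory state, i.e. $\lceil\log_2(\text{number of memory states})\rceil$. *Oblivious linear-state algorithms.* Let $\mathcal A$ be a streaming algorithm that processes pairs $(x,q)\in X\times\{0,1\}$ (an update and a query demand) and whose memory has three segments: $S_R$, drawn at random at the beginning and then kept fixed; $S_v$, holding an encoding of a vector of $\mathbb R^d$; and $S_c$, work space. All of its randomness is in $S_R$, and its response to a query is a function of $S_R$ and of the vector encoded in $S_v$. Write $S_v(\vec u)$ for the vector encoded after processing $\vec u\in(X\times\{0,1\})^*$. $\mathcal A$ is *linear state* for stream length $m$ if, for every value of $S_R$ and all $\vec u_1,\vec u_2$ of total length at most $m$, $S_v(\vec u_1\circ\vec u_2)=S_v(\vec u_1)+S_v(\vec u_2)$ (all three executions using the same $S_R$). $\mathcal A$ is *oblivious for $g$ with stream length $m$, accuracy $\alpha$ and failure probability $\beta_0$* if for every fixed $(x_1,\dots,x_m)\in X^m$, when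 $\mathcal A$ is queried in every round, with probability at least $1-\beta_0$ over its coins its responses $z_1,\dots,z_m$ satisfy $z_i\in(1\pm\alpha)\cdot g(x_1,\dots,x_i)$ for all $i$. *The ASA game* with $m$ rounds, at most $T$ queries and query/advice rate $\eta$: in round $i$ the (randomized) adversary, knowing its previous choices and all previous responses, chooses $x_i\in X$ and $q_i\in\{0,1\}$ subject to $\sum_{j\le i}q_j\le T$; the algorithm processes $x_i$; if $q_i=1$, it outputs a response $z_i\in\mathbb R$, which is given to the adversary, and if moreover $\sum_{j\le i}q_j\equiv 0\pmod\eta$, it specifies a predicate $p_i:X^*\to\{0,1\}$ and obtains the bit $p_i(x_1,\dots,x_i)$. The algorithm may use fresh random coins in every step, but between steps it keeps only its memory state, which also determines $p_i$. It is *adversarially robust for $g$ with accuracy $\alpha$ and failure probability $\beta$* if against every adversary, with probability at least $1-\beta$, every response satisfies $z_i\in(1\pm\alpha)\cdot g(x_1,\dots,x_i)$. **Theorem.** For every $c\in\mathbb N$ there is a constant $C>0$, depending only on $c$, such that the following holds. Let $m,\eta\ge1$ and $s\ge 0$ be integers, $\alpha>0$, $0<\beta<1$, let $X$ be a finite domain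 with $|X|\le m^{c}$, and let $g:X^*\to\mathbb R$. Suppose that $\mathcal A$ is a linear-state oblivious streaming algorithm for $g$ with stream length $m$, accuracy $\alpha$ and failure probability $1/10$ that uses space at most $s$. Then there is a streaming algorithm using space at most $$C\cdot\eta\, s^2\,\log\!\left(\frac m\beta\right)\log^2\!\left(\frac m{\beta\alpha}\right)$$ that, for every $T$, is adversarially robust for $g$ in the ASA game with $m$ rounds, at most $T$ queries and query/advice rate $\eta$, with accuracy $\alpha$ and failure probability $\beta$. -/

import Mathlib

namespace Streaming

/-- `z ∈ (1 ± α) · y`: the estimate `z` is within relative error `α` of the true value `y`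
(which may be negative or zero). -/
def Accurate (α y z : ℝ) : Prop := |z - y| ≤ α * |y|

/-- A streaming algorithm over the domain `X` whose memory consists of three segments: `SR`, drawn
at random at the beginning and then kept fixed; `SV`, holding an encoding of a vector of `ℝ ^ d`;
and `SC`, work space for the remaining computations. It processes pairs `(x, q)` of an update and a
query demand. As the work space is not part of the summary of the stream, the response is computed
from the random segment and the encoded vector. -/
structure SegmentedAlgorithm (X : Type*) where
  SR : Type
  SV : Type
  SC : Type
  [fintypeSR : Fintype SR]
  [fintypeSV : Fintype SV]
  [fintypeSC : Fintype SC]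
  d : ℕ
  vec : SV → (Fin d → ℝ)
  coins : PMF SR
  initV : SR → SV
  initC : SR → SC
  update : SR → SV × SC → X × Bool → SV × SC
  respond : SR → (Fin d → ℝ) → ℝ

attribute [instance] SegmentedAlgorithm.fintypeSR SegmentedAlgorithm.fintypeSV
  SegmentedAlgorithm.fintypeSC

namespace SegmentedAlgorithm

variable {X : Type*} (A : SegmentedAlgorithm X)

/-- The number of bits needed to store the whole memory (all three segments). -/
def space : ℕ := Nat.clog 2 (Fintype.card (A.SR × A.SV × A.SC))

/-- The content of the second and third memory segments after processing the stream `u`, when the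
random segment is `r`. -/
def run (r : A.SR) (u : List (X × Bool)) : A.SV × A.SC :=
  u.foldl (A.update r) (A.initV r, A.initC r)

/-- The vector encoded in the second memory segment after processing the stream `u`. -/
def Sv (r : A.SR) (u : List (X × Bool)) : Fin A.d → ℝ := A.vec (A.run r u).1

/-- Linear state, for streams of length at most `m`: with the same random segment in all three
executions, the encoded vector of a concatenation is the sum of the encoded vectors. -/
def IsLinearState (m : ℕ) : Prop :=
  ∀ (r : A.SR) (u₁ u₂ : List (X × Bool)), u₁.length + u₂.length ≤ m →
    A.Sv r (u₁ ++ u₂) = A.Sv r u₁ + A.Sv r u₂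

/-- The response given after the updates `x`, when the algorithm is queried in every round. -/
def output (r : A.SR) (x : List X) : ℝ :=
  A.respond r (A.Sv r (x.map fun a => (a, true)))

/-- Oblivious streaming algorithm for `g` with stream length `m`, accuracy `α` and failure
probability `β`: for every fixed stream of length `m`, all `m` responses are accurate with
probability at least `1 - β` over the coins of the algorithm. -/
def IsOblivious (g : List X → ℝ) (m : ℕ) (α β : ℝ) : Prop :=
  ∀ x : List X, x.length = m →
    ENNReal.ofReal (1 - β) ≤ A.coins.toOuterMeasure
      {r | ∀ i, 1 ≤ i → i ≤ m → Accurate α (g (x.take i)) (A.output r (x.take i))}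

end SegmentedAlgorithm

/-- A record of the rounds played so far, in chronological order: the update of each round, and the
response `some z` if the round was a query (`none` if it was not). -/
abbrev Transcript (X : Type*) := List (X × Option ℝ)

namespace Transcript

variable {X : Type*}

/-- The updates `x₁, x₂, …` of the rounds played so far. -/
def updates (h : Transcript X) : List X := h.map Prod.fst

/-- The number of queries posed so far. -/
def queries (h : Transcript X) : ℕ := h.countP fun p => p.2.isSome

/-- Every response given so far is accurate for the stream up to its round. -/
def AllAccurate (g : List X → ℝ) (α : ℝ) (h : Transcript X) : Prop :=
  ∀ (i : ℕ) (hi : i < h.length) (z : ℝ), (h[i]).2 = some z →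
    Accurate α (g (updates (h.take (i + 1)))) z

end Transcript

/-- A (randomized, adaptive) adversary: from everything it has seen so far it chooses the next
update and query demand. -/
def Adversary (X : Type*) := Transcript X → PMF (X × Bool)

/-- The adversary never poses more than `T` queries. -/
def Adversary.QueryBounded {X : Type*} (B : Adversary X) (T : ℕ) : Prop :=
  ∀ h : Transcript X, h.queries ≤ T → ∀ p ∈ (B h).support, h.queries + p.2.toNat ≤ T

/-- A randomized streaming algorithm with advice. All that it remembers from one step to the next is
an element of the finite type `State`; each step may use fresh coins. -/
structure ASAAlgorithm (X : Type*) where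
  State : Type
  [fintypeState : Fintype State]
  /-- the initial state -/
  init : PMF State
  /-- process an update -/
  update : State → X → PMF State
  /-- respond to a query -/
  answer : State → PMF (ℝ × State)
  /-- the predicate specified when advice is available -/
  predicate : State → List X → Bool
  /-- process the advice bit -/
  receive : State → Bool → PMF State

attribute [instance] ASAAlgorithm.fintypeState

namespace ASAAlgorithm

variable {X : Type*} (A : ASAAlgorithm X)

/-- The number of bits needed to store the state. -/
def space : ℕ := Nat.clog 2 (Fintype.card A.State)

/-- One round of the game with query/advice rate `η`: the adversary chooses an update and a query
demand, the algorithm processes the update; if it is queried it responds, and if moreover the number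
of queries so far is a multiple of `η` it obtains the value of its predicate on the stream so far. -/
noncomputable def round (η : ℕ) (B : Adversary X) (c : A.State × Transcript X) :
    PMF (A.State × Transcript X) :=
  (B c.2).bind fun p =>
    (A.update c.1 p.1).bind fun σ =>
      if p.2 then
        (A.answer σ).bind fun y =>
          let h := c.2 ++ [(p.1, some y.1)]
          if Transcript.queries h % η = 0 then
            (A.receive y.2 (A.predicate y.2 (Transcript.updates h))).map fun τ => (τ, h)
          else PMF.pure (y.2, h)
      else PMF.pure (σ, c.2 ++ [(p.1, none)])

/-- The joint law of the state and the transcript after a given number of rounds. -/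
noncomputable def play (η : ℕ) (B : Adversary X) : ℕ → PMF (A.State × Transcript X)
  | 0 => A.init.map fun σ => (σ, [])
  | n + 1 => (play η B n).bind (A.round η B)

/-- Adversarially robust for `g` in the game with advice with `m` rounds, at most `T` queries and
query/advice rate `η`: against every adversary, with probability at least `1 - β` all responses
given at query times are `α`-accurate. -/
def IsRobust (g : List X → ℝ) (m T η : ℕ) (α β : ℝ) : Prop :=
  ∀ B : Adversary X, B.QueryBounded T →
    ENNReal.ofReal (1 - β) ≤
      (A.play η B m).toOuterMeasure {c | Transcript.AllAccurate g α c.2}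

end ASAAlgorithm

end Streaming

/-!
A linear state splits over time: the encoded vector of a stream is the sum of those of a prefix and
of the remaining suffix. So an algorithm with advice can use fresh oblivious copies in the middle of
the stream: it requests the encoded vectors of the prefix bit by bit, and runs the copies on the
suffix itself. The robust algorithm therefore works in epochs, each with a pool of `k` independent
oblivious copies that is used during that epoch only, while the advice serves to prepare the pool of
the next one; an epoch has `η * (k * s)` queries, for the `k` vectors of `s` bits each.

Within an epoch a query is answered by a randomized approximate median of the `k` outputs, in which
a candidate has a weight exponential in its quality. Ignoring any `l` of the copies changes the law
of one answer, in the `χ²` sense, by a factor `a`, and hence that of an epoch with `Q` queries by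
`a ^ Q`. Under the law in which a set `J` of `l` copies is ignored, these copies are independent of
the stream, so they all fail with probability at most `δ ^ l`; by Cauchy-Schwarz, this probability
is at most `(a ^ Q * δ ^ l) ^ (1 / 2)` under the true law. Counting the sets `J` shows that, except
with probability exponentially small in `l`, a clear majority of the outputs is accurate at every
query, and then every point near the median is accurate. In order that the number of possible
outputs does not matter for the weights, the quality of a candidate is read off a search tree, where
only a bounded number of candidates per bit of memory have a positive quality.

With `l ≈ 30 * log (m / β)` copies ignored, this costs `O(l ^ 3 * η * s ^ 2)` bits. For
`m ≤ η * s ^ 2` it is cheaper to store the whole stream.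
-/

open scoped ENNReal NNReal Finset

namespace Streaming

section Expectation

variable {α β : Type*}

/-- The expectation of an extended nonnegative function under a discrete distribution. -/
noncomputable def expect (P : PMF α) (f : α → ℝ≥0∞) : ℝ≥0∞ := ∑' a, P a * f a

theorem expect_mono_of_support {P : PMF α} {f g : α → ℝ≥0∞} (h : ∀ a ∈ P.support, f a ≤ g a) :
    expect P f ≤ expect P g := by
  refine ENNReal.tsum_le_tsum fun a => ?_
  by_cases ha : a ∈ P.support
  · exact mul_le_mul_right (h a ha) _
  · rw [(P.apply_eq_zero_iff a).2 ha, zero_mul]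
    exact zero_le

theorem expect_mono {P : PMF α} {f g : α → ℝ≥0∞} (h : ∀ a, f a ≤ g a) :
    expect P f ≤ expect P g := expect_mono_of_support fun a _ => h a

theorem expect_const (P : PMF α) (c : ℝ≥0∞) : expect P (fun _ => c) = c := by
  simp [expect, ENNReal.tsum_mul_right, P.tsum_coe]

theorem expect_pure (a : α) (f : α → ℝ≥0∞) : expect (PMF.pure a) f = f a := by
  classical
  rw [expect, tsum_eq_single a]
  · simp
  · intro b hb
    simp [PMF.pure_apply, hb]

theorem expect_bind (P : PMF α) (K : α → PMF β) (f : β → ℝ≥0∞) :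
    expect (P.bind K) f = expect P fun a => expect (K a) f := by
  simp only [expect, PMF.bind_apply, ← ENNReal.tsum_mul_right, ← ENNReal.tsum_mul_left]
  rw [ENNReal.tsum_comm]
  simp only [mul_assoc]

theorem expect_map (P : PMF α) (φ : α → β) (f : β → ℝ≥0∞) :
    expect (P.map φ) f = expect P fun a => f (φ a) := by
  rw [← PMF.bind_pure_comp, expect_bind]
  simp only [Function.comp_apply, expect_pure]

theorem expect_const_mul (P : PMF α) (c : ℝ≥0∞) (f : α → ℝ≥0∞) :
    expect P (fun a => c * f a) = c * expect P f := by
  simp only [expect, ← ENNReal.tsum_mul_left, mul_left_comm]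

theorem expect_finset_sum {ι : Type*} (P : PMF α) (s : Finset ι) (f : ι → α → ℝ≥0∞) :
    expect P (fun a => ∑ i ∈ s, f i a) = ∑ i ∈ s, expect P (f i) := by
  simp only [expect, Finset.mul_sum]
  exact Summable.tsum_finsetSum fun _ _ => ENNReal.summable

theorem toOuterMeasure_eq_expect (P : PMF α) (S : Set α) :
    P.toOuterMeasure S = expect P (S.indicator 1) := by
  rw [PMF.toOuterMeasure_apply, expect]
  exact tsum_congr fun a => by by_cases ha : a ∈ S <;> simp [ha]

theorem toOuterMeasure_add_compl (P : PMF α) (S : Set α) :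
    P.toOuterMeasure S + P.toOuterMeasure Sᶜ = 1 := by
  rw [PMF.toOuterMeasure_apply, PMF.toOuterMeasure_apply, ← ENNReal.tsum_add, ← P.tsum_coe]
  exact tsum_congr fun a => congrFun (Set.indicator_self_add_compl S P) a

theorem toOuterMeasure_le_ofReal_iff (P : PMF α) (S : Set α) {b : ℝ} (hb : 0 ≤ b) :
    P.toOuterMeasure S ≤ ENNReal.ofReal b ↔
      ENNReal.ofReal (1 - b) ≤ P.toOuterMeasure Sᶜ := by
  have hne : P.toOuterMeasure Sᶜ ≠ ⊤ := ne_top_of_le_ne_top ENNReal.one_ne_top <|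
    (self_le_add_left _ _).trans (toOuterMeasure_add_compl P S).le
  rw [ENNReal.ofReal_sub _ hb, ENNReal.ofReal_one, ← toOuterMeasure_add_compl P S,
    tsub_le_iff_left, ENNReal.add_le_add_iff_right hne]

theorem toOuterMeasure_le_one (P : PMF α) (S : Set α) : P.toOuterMeasure S ≤ 1 :=
  le_self_add.trans (toOuterMeasure_add_compl P S).le

theorem toOuterMeasure_bind_le_add {P : PMF α} {K : α → PMF β} {S : Set β} {T : Set α} {b : ℝ≥0∞}
    (h : ∀ a ∈ P.support, a ∉ T → (K a).toOuterMeasure S ≤ b) :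
    (P.bind K).toOuterMeasure S ≤ P.toOuterMeasure T + b := by
  rw [PMF.toOuterMeasure_bind_apply, PMF.toOuterMeasure_apply, ← expect_const P b, expect,
    ← ENNReal.tsum_add]
  refine ENNReal.tsum_le_tsum fun a => ?_
  by_cases ha : a ∈ P.support
  · by_cases haT : a ∈ T
    · rw [Set.indicator_of_mem haT]
      exact (mul_le_of_le_one_right' (toOuterMeasure_le_one _ S)).trans le_self_add
    · exact (mul_le_mul_right (h a ha haT) _).trans le_add_self
  · rw [(P.apply_eq_zero_iff a).2 ha, zero_mul]
    exact zero_le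

theorem toOuterMeasure_bind_le {P : PMF α} {K : α → PMF β} {S : Set β} {b : ℝ≥0∞}
    (h : ∀ a ∈ P.support, (K a).toOuterMeasure S ≤ b) : (P.bind K).toOuterMeasure S ≤ b := by
  simpa only [MeasureTheory.measure_empty, zero_add] using
    toOuterMeasure_bind_le_add (T := ∅) fun a ha _ => h a ha

theorem bind_congr_support {P : PMF α} {K K' : α → PMF β} (h : ∀ a ∈ P.support, K a = K' a) :
    P.bind K = P.bind K' := by
  ext b
  simp only [PMF.bind_apply]
  refine tsum_congr fun a => ?_
  by_cases ha : a ∈ P.support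
  · rw [h a ha]
  · rw [(P.apply_eq_zero_iff a).2 ha, zero_mul, zero_mul]

theorem map_congr_support {P : PMF α} {f f' : α → β} (h : ∀ a ∈ P.support, f a = f' a) :
    P.map f = P.map f' :=
  bind_congr_support fun a ha => congrArg PMF.pure (h a ha)

end Expectation

section SqDominated

variable {α β : Type*}

/-- The second moments under `P'` control the first moments under `P` up to the factor `a`. When
`P ≪ P'` this says that the second moment of the density of `P` with respect to `P'`, that is one
plus their `χ²`-divergence, is at most `a`. -/
def SqDominated (a : ℝ≥0∞) (P P' : PMF α) : Prop :=
  ∀ f : α → ℝ≥0∞, expect P f ^ 2 ≤ a * expect P' fun x => f x ^ 2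

theorem sqDominated_of_sum_le [Fintype α] {a : ℝ≥0∞} {P P' : PMF α}
    (hPP' : ∀ x, P' x = 0 → P x = 0) (h : ∑ x, P x ^ 2 / P' x ≤ a) : SqDominated a P P' := by
  intro f
  have hprod : ∀ x, P x * f x = P x / P' x ^ (1 / 2 : ℝ) * (P' x ^ (1 / 2 : ℝ) * f x) := by
    intro x
    rcases eq_or_ne (P' x) 0 with h0 | h0
    · simp [hPP' x h0]
    · rw [← mul_assoc, ENNReal.div_mul_cancel]
      · simp [h0]
      · exact (ENNReal.rpow_lt_top_of_nonneg (by norm_num) (P'.apply_ne_top x)).ne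
  have hsqrt : ∀ b : ℝ≥0∞, (b ^ (1 / 2 : ℝ)) ^ 2 = b := fun b => by
    rw [← ENNReal.rpow_natCast, ← ENNReal.rpow_mul]
    norm_num
  have hholder := ENNReal.inner_le_Lp_mul_Lq Finset.univ
    (fun x => P x / P' x ^ (1 / 2 : ℝ)) (fun x => P' x ^ (1 / 2 : ℝ) * f x)
    Real.HolderConjugate.two_two
  have hdiv : ∀ x, (P x / P' x ^ (1 / 2 : ℝ)) ^ 2 = P x ^ 2 / P' x := fun x => by
    rw [div_eq_mul_inv, mul_pow, ← ENNReal.inv_pow, hsqrt, div_eq_mul_inv]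
  simp only [← hprod, ENNReal.rpow_two, mul_pow, hsqrt, hdiv] at hholder
  rw [expect, expect, tsum_fintype, tsum_fintype]
  calc _ ≤ _ := pow_le_pow_left' hholder 2
    _ = (∑ x, P x ^ 2 / P' x) * ∑ x, P' x * f x ^ 2 := by rw [mul_pow, hsqrt, hsqrt]
    _ ≤ _ := mul_le_mul_left h _

theorem SqDominated.refl (P : PMF α) : SqDominated 1 P P := by
  intro f
  have two_mul_le (u v : ℝ≥0∞) : 2 * (u * v) ≤ u ^ 2 + v ^ 2 := by
    cases u with
    | top => simp
    | coe u =>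
      cases v with
      | top => simp
      | coe v => exact_mod_cast (mul_assoc 2 u v).symm.trans_le (two_mul_le_add_sq u v)
  have hsq : expect P f ^ 2 = expect P fun x => expect P fun y => f x * f y := by
    simp only [expect_const_mul, sq, mul_comm _ (expect P f)]
  have hadd : ∀ g h : α → ℝ≥0∞, expect P (fun x => g x + h x) = expect P g + expect P h :=
    fun g h => by simp only [expect, mul_add, ENNReal.tsum_add]
  refine (ENNReal.mul_le_mul_iff_right two_ne_zero ENNReal.ofNat_ne_top).1 ?_
  calc 2 * expect P f ^ 2 = expect P fun x => expect P fun y => 2 * (f x * f y) := by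
        simp only [hsq, expect_const_mul]
    _ ≤ expect P fun x => expect P fun y => f x ^ 2 + f y ^ 2 :=
        expect_mono fun x => expect_mono fun y => two_mul_le (f x) (f y)
    _ = 2 * (1 * expect P fun x => f x ^ 2) := by
        simp only [hadd, expect_const, two_mul, one_mul]

theorem SqDominated.bind {a b : ℝ≥0∞} {P P' : PMF α} {K K' : α → PMF β}
    (hP : SqDominated a P P') (hK : ∀ x, SqDominated b (K x) (K' x)) :
    SqDominated (a * b) (P.bind K) (P'.bind K') := by
  intro f
  rw [expect_bind, expect_bind]
  calc _ ≤ a * expect P' fun x => expect (K x) f ^ 2 := hP _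
    _ ≤ a * expect P' fun x => b * expect (K' x) fun y => f y ^ 2 :=
        mul_le_mul_right (expect_mono fun x => hK x f) a
    _ = _ := by rw [expect_const_mul, mul_assoc]

theorem SqDominated.mono {a b : ℝ≥0∞} (hab : a ≤ b) {P P' : PMF α} (h : SqDominated a P P') :
    SqDominated b P P' := fun f => (h f).trans (mul_le_mul_left hab _)

theorem SqDominated.map {a : ℝ≥0∞} {P P' : PMF α} (h : SqDominated a P P') (φ : α → β) :
    SqDominated a (P.map φ) (P'.map φ) := by
  intro f
  rw [expect_map, expect_map]
  exact h _

theorem SqDominated.toOuterMeasure_sq_le {a : ℝ≥0∞} {P P' : PMF α} (h : SqDominated a P P')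
    (S : Set α) : P.toOuterMeasure S ^ 2 ≤ a * P'.toOuterMeasure S := by
  rw [toOuterMeasure_eq_expect, toOuterMeasure_eq_expect]
  refine (h _).trans_eq ?_
  congr 2 with x
  by_cases hx : x ∈ S <;> simp [hx]

end SqDominated

section Iid

variable {ι R : Type*} [Fintype ι] [DecidableEq ι] [Fintype R]

theorem sum_coe_eq_one (μ : PMF R) : ∑ r, μ r = 1 := by
  rw [← μ.tsum_coe, tsum_fintype]

variable (ι) in
/-- The law of a family of independent samples from `μ`, indexed by `ι`. -/
noncomputable def iid (μ : PMF R) : PMF (ι → R) :=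
  PMF.ofFintype (fun ρ => ∏ j, μ (ρ j)) <| by
    classical
    rw [← Fintype.piFinset_univ, ← Finset.prod_univ_sum]
    simp only [sum_coe_eq_one, Finset.prod_const_one]

theorem expect_iid (μ : PMF R) (f : (ι → R) → ℝ≥0∞) :
    expect (iid ι μ) f = ∑ ρ, (∏ j, μ (ρ j)) * f ρ := by
  classical exact tsum_fintype _

theorem expect_iid_piecewise (μ : PMF R) (J : Finset ι) (f : (ι → R) → ℝ≥0∞) :
    (expect (iid ι μ) fun ρ => expect (iid ι μ) fun ρ' => f (J.piecewise ρ' ρ)) =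
      expect (iid ι μ) f := by
  classical
  have hconst : expect (iid ι μ) f = expect (iid ι μ) fun ρ => expect (iid ι μ) fun _ => f ρ := by
    simp only [expect_const]
  rw [hconst]
  simp only [expect_iid, Finset.mul_sum]
  rw [← Fintype.sum_prod_type', ← Fintype.sum_prod_type']
  let swap : (ι → R) × (ι → R) → (ι → R) × (ι → R) :=
    fun p => (J.piecewise p.2 p.1, J.piecewise p.1 p.2)
  have hswap : Function.Involutive swap := by
    rintro ⟨ρ, ρ'⟩
    refine Prod.ext ?_ ?_ <;> funext j <;> by_cases hj : j ∈ J <;> simp [swap, hj]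
  refine Fintype.sum_equiv hswap.toPerm _ _ fun p => ?_
  simp only [Function.Involutive.coe_toPerm, swap]
  rw [← mul_assoc, ← mul_assoc, ← Finset.prod_mul_distrib, ← Finset.prod_mul_distrib]
  congr 1
  refine Finset.prod_congr rfl fun j _ => ?_
  by_cases hj : j ∈ J <;> simp [hj, mul_comm]

theorem iid_bind_map_piecewise (μ : PMF R) (J : Finset ι) :
    ((iid ι μ).bind fun ρ => (iid ι μ).map fun ρ' => J.piecewise ρ' ρ) = iid ι μ := by
  refine PMF.toOuterMeasure_injective (MeasureTheory.OuterMeasure.ext fun S => ?_)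
  simpa only [toOuterMeasure_eq_expect, expect_bind, expect_map] using
    expect_iid_piecewise μ J (S.indicator 1)

theorem expect_iid_prod (μ : PMF R) (J : Finset ι) (F : R → ℝ≥0∞) :
    expect (iid ι μ) (fun ρ => ∏ j ∈ J, F (ρ j)) = expect μ F ^ #J := by
  classical
  calc expect (iid ι μ) (fun ρ => ∏ j ∈ J, F (ρ j))
      = ∑ ρ : ι → R, ∏ j, μ (ρ j) * if j ∈ J then F (ρ j) else 1 := by
        simp only [expect_iid, Finset.prod_mul_distrib, Finset.prod_ite_mem, Finset.univ_inter]
    _ = ∏ j, ∑ r, μ r * if j ∈ J then F r else 1 := by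
        rw [← Fintype.piFinset_univ, Finset.prod_univ_sum]
    _ = ∏ j, if j ∈ J then expect μ F else 1 := by
        refine Finset.prod_congr rfl fun j _ => ?_
        split_ifs
        · rw [expect, tsum_fintype]
        · simp only [mul_one, sum_coe_eq_one]
    _ = expect μ F ^ #J := by
        rw [Finset.prod_ite_mem, Finset.univ_inter, Finset.prod_const]

theorem toOuterMeasure_iid_forall_mem (μ : PMF R) (J : Finset ι) (S : Set R) :
    (iid ι μ).toOuterMeasure {ρ | ∀ j ∈ J, ρ j ∈ S} = μ.toOuterMeasure S ^ #J := by
  classical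
  rw [toOuterMeasure_eq_expect, toOuterMeasure_eq_expect, ← expect_iid_prod]
  congr 1 with ρ
  by_cases hρ : ρ ∈ {ρ : ι → R | ∀ j ∈ J, ρ j ∈ S}
  · rw [Set.indicator_of_mem hρ, Pi.one_apply]
    exact (Finset.prod_eq_one fun j hj => Set.indicator_of_mem (hρ j hj) _).symm
  · rw [Set.indicator_of_notMem hρ]
    simp only [Set.mem_ofPred_eq, not_forall] at hρ
    obtain ⟨j, hj, hjS⟩ := hρ
    exact (Finset.prod_eq_zero hj (Set.indicator_of_notMem hjS _)).symm

end Iid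

section SearchTree

theorem exists_median {ι α : Type*} [LinearOrder α] (D : Finset ι) (hD : D.Nonempty) (y : ι → α) :
    ∃ j ∈ D, #D ≤ 2 * #{i ∈ D | y i ≤ y j} ∧ #D ≤ 2 * #{i ∈ D | y j ≤ y i} := by
  obtain ⟨M, hM, hMmax⟩ := D.exists_max_image y hD
  let E := {j ∈ D | #D ≤ 2 * #{i ∈ D | y i ≤ y j}}
  have hE : E.Nonempty := by
    refine ⟨M, Finset.mem_filter.2 ⟨hM, ?_⟩⟩
    rw [Finset.filter_true_of_mem hMmax]
    omega
  obtain ⟨j, hj, hjmin⟩ := E.exists_min_image y hE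
  obtain ⟨hjD, hjle⟩ := Finset.mem_filter.1 hj
  refine ⟨j, hjD, hjle, ?_⟩
  by_contra hlt
  have hsplit := Finset.card_filter_add_card_filter_not (s := D) fun i => y j ≤ y i
  have hne : {i ∈ D | ¬ y j ≤ y i}.Nonempty := by
    rw [← Finset.card_pos]
    omega
  obtain ⟨j', hj', hj'max⟩ := Finset.exists_max_image _ y hne
  obtain ⟨hj'D, hj'lt⟩ := Finset.mem_filter.1 hj'
  have hsub : #{i ∈ D | ¬ y j ≤ y i} ≤ #{i ∈ D | y i ≤ y j'} :=
    Finset.card_le_card fun i hi =>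
      Finset.mem_filter.2 ⟨(Finset.mem_filter.1 hi).1, hj'max i hi⟩
  exact hj'lt (hjmin j' (Finset.mem_filter.2 ⟨hj'D, by omega⟩))

variable {α : Type*} [LinearOrder α]

open scoped Classical in
/-- The cells `cell z` of the nodes `z ∈ V` of a search tree of depth at most `S`. The points
whose search path passes through `z` form `cell z`, so that a point lies in at most `S` cells. If
the descent towards `v ∈ V` through a data set is stopped at the last node `z` whose cell contains
`t` data points, then few data points lie between `z` and `v`. -/
structure IsSearchTree (S : ℕ) (V : Finset α) (cell : α → Set α) : Prop where
  card_le : ∀ y, #{z ∈ V | y ∈ cell z} ≤ S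
  exists_heavy : ∀ (D : Multiset α) (t : ℕ), t ≤ D.card → ∀ v ∈ V, ∃ z ∈ V,
    t ≤ (D.filter (· ∈ cell z)).card ∧ (D.filter (· ∈ Set.uIcc z v \ {z})).card ≤ t

open scoped Classical in
theorem IsSearchTree.exists_heavy_of_side {S : ℕ} {V W : Finset α} {cell cellB : α → Set α}
    {c : α} {B : Set α} (hB : B.OrdConnected) (hcB : ∀ v ∈ B, Set.uIcc c v \ {c} ⊆ B)
    (hWV : ∀ z, z ∈ W ↔ z ∈ V ∧ z ∈ B) (hW : IsSearchTree S W cellB) (hc : c ∈ V)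
    (hcellc : cell c = Set.univ) (hcellB : ∀ z ∈ B, cell z = B ∩ cellB z)
    (D : Multiset α) {t : ℕ} (ht : t ≤ D.card) {v : α} (hv : v ∈ V) (hvB : v ∈ B) :
    ∃ z ∈ V, t ≤ (D.filter (· ∈ cell z)).card ∧
      (D.filter (· ∈ Set.uIcc z v \ {z})).card ≤ t := by
  by_cases hDB : t ≤ (D.filter (· ∈ B)).card
  · obtain ⟨z, hz, hheavy, hbetween⟩ :=
      hW.exists_heavy (D.filter (· ∈ B)) t hDB v ((hWV v).2 ⟨hv, hvB⟩)
    obtain ⟨hzV, hzB⟩ := (hWV z).1 hz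
    rw [Multiset.filter_filter] at hheavy hbetween
    refine ⟨z, hzV, hheavy.trans ?_, le_trans ?_ hbetween⟩ <;>
      refine Multiset.card_le_card (Multiset.monotone_filter_right D fun y hy => ?_)
    · exact hcellB z hzB ▸ ⟨hy.2, hy.1⟩
    · exact ⟨hy, hB.uIcc_subset hzB hvB hy.1⟩
  · refine ⟨c, hc, ?_, le_trans ?_ (not_le.1 hDB).le⟩
    · simpa only [hcellc, Set.mem_univ, Multiset.filter_true] using ht
    · exact Multiset.card_le_card (Multiset.monotone_filter_right D fun y hy => hcB v hvB hy)

open scoped Classical in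
/-- The cells of the search tree with root `c`, given the cells of its left and right subtrees. -/
def joinCells (c : α) (left right : α → Set α) (z : α) : Set α :=
  if z = c then Set.univ else if z < c then Set.Iio c ∩ left z else Set.Ioi c ∩ right z

open scoped Classical in
theorem IsSearchTree.join {S : ℕ} {V : Finset α} {left right : α → Set α} {c : α} (hc : c ∈ V)
    (hleft : IsSearchTree S {z ∈ V | z < c} left)
    (hright : IsSearchTree S {z ∈ V | c < z} right) :
    IsSearchTree (S + 1) V (joinCells c left right) where
  card_le y := by
    rcases lt_or_ge y c with hy | hy
    · have hsub : {z ∈ V | y ∈ joinCells c left right z} ⊆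
          insert c {z ∈ {z ∈ V | z < c} | y ∈ left z} := by grind [joinCells]
      exact (Finset.card_le_card hsub).trans <| (Finset.card_insert_le _ _).trans <|
        Nat.succ_le_succ (hleft.card_le y)
    · have hsub : {z ∈ V | y ∈ joinCells c left right z} ⊆
          insert c {z ∈ {z ∈ V | c < z} | y ∈ right z} := by grind [joinCells]
      exact (Finset.card_le_card hsub).trans <| (Finset.card_insert_le _ _).trans <|
        Nat.succ_le_succ (hright.card_le y)
  exists_heavy D t ht v hv := by
    have hroot : joinCells c left right c = Set.univ := if_pos rfl
    rcases lt_trichotomy v c with hvc | rfl | hvc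
    · refine hleft.exists_heavy_of_side Set.ordConnected_Iio ?_ (by simp) hc hroot ?_ D ht hv hvc
      · rintro w hw y ⟨hy, hyc⟩
        exact lt_of_le_of_ne (Set.uIcc_of_ge (le_of_lt hw) ▸ hy).2 hyc
      · exact fun z hz => (if_neg hz.ne).trans (if_pos hz)
    · exact ⟨v, hv, by simpa only [hroot, Set.mem_univ, Multiset.filter_true] using ht, by simp⟩
    · refine hright.exists_heavy_of_side Set.ordConnected_Ioi ?_ (by simp) hc hroot ?_ D ht hv hvc
      · rintro w hw y ⟨hy, hyc⟩
        exact lt_of_le_of_ne (Set.uIcc_of_le (le_of_lt hw) ▸ hy).1 (Ne.symm hyc)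
      · exact fun z hz => (if_neg hz.ne').trans (if_neg hz.not_gt)

theorem exists_isSearchTree (S : ℕ) (V : Finset α) (hV : #V < 2 ^ S) :
    ∃ cell, IsSearchTree S V cell := by
  classical
  induction S generalizing V with
  | zero =>
    obtain rfl : V = ∅ := Finset.card_eq_zero.1 (by omega)
    exact ⟨fun _ => ∅, by simp, by simp⟩
  | succ S ih =>
    rcases V.eq_empty_or_nonempty with rfl | hne
    · exact ⟨fun _ => ∅, by simp, by simp⟩
    obtain ⟨c, hc, hle, hge⟩ := exists_median V hne id
    have hlt := Finset.card_filter_add_card_filter_not (s := V) fun z => z ≤ c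
    have hgt := Finset.card_filter_add_card_filter_not (s := V) fun z => c ≤ z
    simp only [id, not_le] at hle hge hlt hgt
    obtain ⟨left, hleft⟩ := ih {z ∈ V | z < c} (by omega)
    obtain ⟨right, hright⟩ := ih {z ∈ V | c < z} (by omega)
    exact ⟨joinCells c left right, hleft.join hc hright⟩

end SearchTree

section Weights

variable {O : Type*} [Fintype O]

/-- The distribution proportional to the weights `w`. -/
noncomputable def ofWeights (w : O → ℝ≥0) (hw : ∑ o, w o ≠ 0) : PMF O :=
  PMF.ofFintype (fun o => ((w o / ∑ o, w o : ℝ≥0) : ℝ≥0∞)) <| by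
    rw [← ENNReal.ofNNReal_finsetSum, ← Finset.sum_div, div_self hw, ENNReal.coe_one]

theorem sq_div_add_le {p m δ : ℝ≥0} (hle : p ≤ (1 + δ) * m) (hge : m ≤ p + δ * m) :
    p ^ 2 / m + m ≤ 2 * p + δ ^ 2 * m := by
  rcases eq_or_ne m 0 with rfl | hm
  · simp
  rw [← NNReal.coe_le_coe] at *
  push_cast at *
  have hm : (0 : ℝ) < m := by positivity
  have hsq : ((p : ℝ) - m) ^ 2 ≤ (δ * m) ^ 2 := sq_le_sq' (by linarith) (by linarith)
  rw [← sub_nonneg]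
  have : (2 * p + δ ^ 2 * m - (p ^ 2 / m + m) : ℝ) = ((δ * m) ^ 2 - (p - m) ^ 2) / m := by
    field_simp
    ring
  rw [this]
  exact div_nonneg (sub_nonneg.2 hsq) hm.le

theorem sum_sq_div_le {p m : O → ℝ≥0} {δ θ : ℝ≥0} (hp : ∑ o, p o = 1) (hm : ∑ o, m o = 1)
    (hδ : δ ≤ 1) (hle : ∀ o, p o ≤ (1 + δ) * m o) (T : Finset O)
    (hge : ∀ o ∉ T, m o ≤ p o + δ * m o) (hT : ∑ o ∈ T, m o ≤ θ) :
    ∑ o, p o ^ 2 / m o ≤ 1 + δ ^ 2 + θ := by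
  classical
  have hpoint (o) : p o ^ 2 / m o + m o ≤ 2 * p o + δ ^ 2 * m o + if o ∈ T then m o else 0 := by
    split_ifs with ho
    · calc _ ≤ 2 * p o + 1 ^ 2 * m o :=
          sq_div_add_le ((hle o).trans (by gcongr)) (by simp)
        _ = 2 * p o + m o := by ring
        _ ≤ _ := by gcongr; exact self_le_add_right _ _
    · simpa only [add_zero] using sq_div_add_le (hle o) (hge o ho)
  have hsum := Finset.sum_le_sum fun o (_ : o ∈ Finset.univ) => hpoint o
  simp only [Finset.sum_add_distrib, ← Finset.mul_sum, hp, hm, Finset.sum_ite_mem,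
    Finset.univ_inter] at hsum
  refine le_of_add_le_add_right (a := 1) (hsum.trans ?_)
  calc _ ≤ 2 * 1 + δ ^ 2 * 1 + θ := by gcongr
    _ = _ := by ring

theorem sqDominated_ofWeights {w w' : O → ℝ≥0} (hw : ∑ o, w o ≠ 0) (hw' : ∑ o, w' o ≠ 0)
    (hww' : ∀ o, w' o = 0 → w o = 0) {a : ℝ≥0}
    (ha : ∑ o, (w o / ∑ o, w o) ^ 2 / (w' o / ∑ o, w' o) ≤ a) :
    SqDominated a (ofWeights w hw) (ofWeights w' hw') := by
  have hzero (o) (ho : w' o / ∑ o, w' o = 0) : w o / ∑ o, w o = 0 := by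
    rw [hww' o ((div_eq_zero_iff.1 ho).resolve_right hw'), zero_div]
  refine sqDominated_of_sum_le (fun o ho => ?_) ?_
  · exact ENNReal.coe_eq_zero.2 (hzero o (ENNReal.coe_eq_zero.1 ho))
  · refine le_trans (Finset.sum_le_sum fun o _ => ?_)
      ((ENNReal.ofNNReal_finsetSum _ _).symm.trans_le (ENNReal.coe_le_coe.2 ha))
    rcases eq_or_ne (w' o / ∑ o, w' o) 0 with ho | ho
    · simp [ofWeights, hzero o ho]
    · rw [ENNReal.coe_div ho, ENNReal.coe_pow]
      rfl

theorem sum_le_mul_sum {w w' : O → ℝ≥0} {x θ : ℝ≥0} (T : Finset O)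
    (hreg : ∀ o ∉ T, w' o ≤ x * w o) (hT : ∑ o ∈ T, w' o ≤ θ * ∑ o, w o) :
    ∑ o, w' o ≤ (x + θ) * ∑ o, w o := by
  classical
  have hpoint (o) : w' o ≤ x * w o + if o ∈ T then w' o else 0 := by
    split_ifs with ho
    · exact self_le_add_left _ _
    · simpa only [add_zero] using hreg o ho
  calc ∑ o, w' o ≤ x * ∑ o, w o + ∑ o ∈ T, w' o := by
        simpa only [Finset.sum_add_distrib, ← Finset.mul_sum, Finset.sum_ite_mem,
          Finset.univ_inter] using Finset.sum_le_sum fun o (_ : o ∈ Finset.univ) => hpoint o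
    _ ≤ (x + θ) * ∑ o, w o := by rw [add_mul]; gcongr

/-- The bound is of second order in `δ`: the first-order terms cancel because both families of
weights are normalized. -/
theorem sqDominated_ofWeights_of_le_mul {w w' : O → ℝ≥0} (hw : ∑ o, w o ≠ 0) (hw' : ∑ o, w' o ≠ 0)
    (hww' : ∀ o, w o ≤ w' o) {x δ θ : ℝ≥0} (hδ : δ ≤ 1) (hxδ : x + θ ≤ 1 + δ) (T : Finset O)
    (hreg : ∀ o ∉ T, w' o ≤ x * w o) (hT : ∑ o ∈ T, w' o ≤ θ * ∑ o, w o) :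
    SqDominated (1 + δ ^ 2 + θ : ℝ≥0) (ofWeights w hw) (ofWeights w' hw') := by
  refine sqDominated_ofWeights hw hw' (fun o ho => le_antisymm (ho ▸ hww' o) zero_le) ?_
  set Z := ∑ o, w o
  set Z' := ∑ o, w' o
  have hZZ' : Z ≤ Z' := Finset.sum_le_sum fun o _ => hww' o
  have hZ'Z : Z' ≤ (1 + δ) * Z :=
    (sum_le_mul_sum T hreg hT).trans (mul_le_mul_left hxδ Z)
  have hle (o) : w o / Z ≤ (1 + δ) * (w' o / Z') := by
    rw [← mul_div_assoc, div_le_div_iff₀ (by positivity) (by positivity)]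
    calc w o * Z' ≤ w' o * ((1 + δ) * Z) := mul_le_mul' (hww' o) hZ'Z
      _ = _ := by ring
  have hge (o) (ho : o ∉ T) : w' o / Z' ≤ w o / Z + δ * (w' o / Z') := by
    have hnum : w' o ≤ w o + δ * w' o := by
      have hx := hreg o ho
      rw [← NNReal.coe_le_coe] at *
      push_cast at *
      nlinarith [sq_nonneg ((x : ℝ) - 1), (w o).coe_nonneg, (w' o).coe_nonneg, θ.coe_nonneg]
    calc w' o / Z' ≤ (w o + δ * w' o) / Z' := by gcongr
      _ = w o / Z' + δ * (w' o / Z') := by rw [add_div, mul_div_assoc]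
      _ ≤ _ := by gcongr
  refine sum_sq_div_le ?_ ?_ hδ hle T hge ?_
  · rw [← Finset.sum_div, div_self hw]
  · rw [← Finset.sum_div, div_self hw']
  · rw [← Finset.sum_div]
    exact div_le_of_le_mul₀ zero_le zero_le (hT.trans (mul_le_mul_right hZZ' θ))

end Weights

section Mechanism

variable {ι : Type*}

open scoped Classical in
/-- The quality of `z` as an interior point of the data `y j`, `j ∈ U`, where all counts are
increased by `t`. By the truncation of the subtractions it is positive only if the cell of `z` is
heavy and many data points lie on either side of `z`. Out of `100 * κ` data points, the median has
`50 * κ` on either side, of which `4 * κ` may be lost in moving to the closest node whose cell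
contains `4 * κ` points: this node has quality `3 * κ`. -/
noncomputable def quality (cell : ℝ → Set ℝ) (κ t : ℕ) (U : Finset ι) (y : ι → ℝ) (z : ℝ) : ℕ :=
  min (#{j ∈ U | y j ∈ cell z} + t - κ)
    (min (#{j ∈ U | y j ≤ z} + t - 43 * κ) (#{j ∈ U | z ≤ y j} + t - 43 * κ))

theorem quality_congr (cell : ℝ → Set ℝ) (κ t : ℕ) {U : Finset ι} {y y' : ι → ℝ}
    (h : ∀ j ∈ U, y j = y' j) : quality cell κ t U y = quality cell κ t U y' := by
  classical
  have hfilter (p : ℝ → Prop) : {j ∈ U | p (y j)} = {j ∈ U | p (y' j)} :=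
    Finset.filter_congr fun j hj => by rw [h j hj]
  funext z
  unfold quality
  rw [hfilter (· ∈ cell z), hfilter (· ≤ z), hfilter (z ≤ ·)]

theorem quality_univ_le [Fintype ι] [DecidableEq ι] (cell : ℝ → Set ℝ) (κ : ℕ) (J : Finset ι)
    (y : ι → ℝ) (z : ℝ) :
    quality cell κ 0 Finset.univ y z ≤ quality cell κ (#J) Jᶜ y z ∧
      quality cell κ (#J) Jᶜ y z ≤ quality cell κ 0 Finset.univ y z + #J := by
  classical
  have hcount (p : ι → Prop) :
      #{j | p j} ≤ #{j ∈ Jᶜ | p j} + #J ∧ #{j ∈ Jᶜ | p j} ≤ #{j | p j} := by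
    refine ⟨?_, Finset.card_le_card (Finset.filter_subset_filter _ (Finset.subset_univ _))⟩
    refine (Finset.card_le_card fun j hj => ?_).trans (Finset.card_union_le _ _)
    by_cases hjJ : j ∈ J <;> simp_all
  have hcell := hcount (y · ∈ cell z)
  have hbelow := hcount (y · ≤ z)
  have habove := hcount (z ≤ y ·)
  simp only [quality, le_min_iff, min_le_iff]
  omega

/-- The weights of the possible responses: `x ^ q z` for a point `z` of quality `q z > 0`, and `W`
for the failure symbol `none`. -/
noncomputable def responseWeight (V : Finset ℝ) (x W : ℝ≥0) (q : ℝ → ℕ) : Option V → ℝ≥0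
  | none => W
  | some z => if q z = 0 then 0 else x ^ q z

theorem responseWeight_le_sum (V : Finset ℝ) (x W : ℝ≥0) (q : ℝ → ℕ) (o : Option V) :
    responseWeight V x W q o ≤ ∑ o, responseWeight V x W q o :=
  Finset.single_le_sum_of_canonicallyOrdered (Finset.mem_univ o)

/-- The random response determined by `responseWeight`, where the failure symbol is answered
by `0`. -/
noncomputable def response (V : Finset ℝ) (x : ℝ≥0) {W : ℝ≥0} (hW : 0 < W) (q : ℝ → ℕ) : PMF ℝ :=
  (ofWeights (responseWeight V x W q)
    (hW.trans_le (responseWeight_le_sum V x W q none)).ne').map fun o => o.elim 0 Subtype.val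

theorem sqDominated_response (V : Finset ℝ) {x W δ θ : ℝ≥0} (hx : 1 ≤ x) (hW : 0 < W)
    {q q' : ℝ → ℕ} {l H : ℕ} (hqq' : ∀ z, q z ≤ q' z ∧ q' z ≤ q z + l)
    (hH : #{z ∈ V | q' z ≠ 0} ≤ H) (hθW : H * x ^ l ≤ θ * W) (hδ : δ ≤ 1)
    (hxδ : x ^ l + θ ≤ 1 + δ) :
    SqDominated (1 + δ ^ 2 + θ : ℝ≥0) (response V x hW q) (response V x hW q') := by
  classical
  let new : Finset (Option V) :=
    Finset.map Function.Embedding.some {z : V | q z = 0 ∧ q' z ≠ 0}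
  have hnew : ∑ o ∈ new, responseWeight V x W q' o ≤ θ * ∑ o, responseWeight V x W q o := by
    have hcard : #{z : V | q z = 0 ∧ q' z ≠ 0} ≤ H := by
      refine (Finset.card_le_card_of_injOn Subtype.val (fun z hz => ?_)
        Subtype.val_injective.injOn).trans hH
      simp_all
    have hweight (z) (hz : z ∈ ({z : V | q z = 0 ∧ q' z ≠ 0} : Finset V)) :
        responseWeight V x W q' (some z) ≤ x ^ l := by
      obtain ⟨hqz, hq'z⟩ := (Finset.mem_filter.1 hz).2
      rw [responseWeight, if_neg hq'z]
      exact pow_le_pow_right₀ hx (by have := (hqq' z).2; omega)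
    rw [Finset.sum_map]
    calc _ ≤ #{z : V | q z = 0 ∧ q' z ≠ 0} • x ^ l := Finset.sum_le_card_nsmul _ _ _ hweight
      _ ≤ H * x ^ l := by rw [nsmul_eq_mul]; gcongr
      _ ≤ θ * W := hθW
      _ ≤ _ := by gcongr; exact responseWeight_le_sum V x W q none
  refine (sqDominated_ofWeights_of_le_mul _ _ ?_ hδ hxδ new ?_ hnew).map _
  · rintro (_ | z)
    · exact le_rfl
    · have := (hqq' z).1
      simp only [responseWeight]
      split_ifs
      any_goals first | omega | exact zero_le
      exact pow_le_pow_right₀ hx this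
  · rintro (_ | z) hz
    · exact le_mul_of_one_le_left' (one_le_pow₀ hx)
    · have := (hqq' z).2
      have hz' : ¬ (q z = 0 ∧ q' z ≠ 0) := by simpa [new] using hz
      simp only [responseWeight]
      split_ifs
      any_goals first | omega | exact zero_le
      rw [← pow_add]
      exact pow_le_pow_right₀ hx (by omega)

theorem toOuterMeasure_response_le (V : Finset ℝ) {x W : ℝ≥0} (hx : 1 ≤ x) (hW : 0 < W)
    {q : ℝ → ℕ} {N : ℕ} (hN : 0 < N) {z : ℝ} (hz : z ∈ V) (hqz : N ≤ q z) :
    (response V x hW q).toOuterMeasure {z | q z = 0} ≤ (W / x ^ N : ℝ≥0) := by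
  rw [response, PMF.toOuterMeasure_map_apply]
  refine (PMF.toOuterMeasure_mono _ (t := {none}) ?_).trans ?_
  · rintro (_ | z) ⟨hz0, hsupp⟩
    · rfl
    · refine absurd ?_ hsupp
      have hz0 : q z = 0 := hz0
      simp [ofWeights, responseWeight, hz0]
  · rw [PMF.toOuterMeasure_apply_singleton]
    have hsum : x ^ N ≤ ∑ o, responseWeight V x W q o := by
      refine le_trans ?_ (responseWeight_le_sum V x W q (some ⟨z, hz⟩))
      rw [responseWeight, if_neg (show q z ≠ 0 by omega)]
      exact pow_le_pow_right₀ hx hqz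
    exact ENNReal.coe_le_coe.2 (div_le_div_of_nonneg_left zero_le (by positivity) hsum)

end Mechanism

section StableMedian

variable {ι : Type*}

/-- A randomized function of the data `y` such that, for each set `J` of `l` indices, its law is
dominated by a law that ignores the data points in `J`. -/
def IsStable (l : ℕ) (a : ℝ≥0∞) (mech : (ι → ℝ) → PMF ℝ) : Prop :=
  ∀ J : Finset ι, #J = l → ∃ mech' : (ι → ℝ) → PMF ℝ,
    (∀ y y', (∀ j ∉ J, y j = y' j) → mech' y = mech' y') ∧
      ∀ y, SqDominated a (mech y) (mech' y)

theorem IsStable.mono {l : ℕ} {a a' : ℝ≥0∞} {mech : (ι → ℝ) → PMF ℝ} (h : IsStable l a mech)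
    (haa' : a ≤ a') : IsStable l a' mech := fun J hJ =>
  let ⟨mech', hignore, hdom⟩ := h J hJ
  ⟨mech', hignore, fun y => (hdom y).mono haa'⟩

variable [Fintype ι]

open scoped Classical in
/-- More than `N` of the data points `y j` are at most `z`, and more than `N` are at least `z`. -/
def IsInterior (N : ℕ) (y : ι → ℝ) (z : ℝ) : Prop :=
  N < #{j | y j ≤ z} ∧ N < #{j | z ≤ y j}

theorem IsSearchTree.card_quality_ne_zero_le {S κ : ℕ} {V : Finset ℝ} {cell : ℝ → Set ℝ}
    (hcell : IsSearchTree S V cell) (hcard : Fintype.card ι = 100 * κ) (hκ : 0 < κ) {t : ℕ}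
    (ht : 2 * t ≤ κ) (U : Finset ι) (y : ι → ℝ) :
    #{z ∈ V | quality cell κ t U y z ≠ 0} ≤ 200 * S := by
  classical
  have hheavy : ∀ z ∈ ({z ∈ V | quality cell κ t U y z ≠ 0} : Finset ℝ),
      κ ≤ 2 * #{j ∈ U | y j ∈ cell z} := by
    intro z hz
    have := (Finset.mem_filter.1 hz).2
    simp only [quality] at this
    omega
  refine Nat.le_of_mul_le_mul_right ?_ hκ
  calc #{z ∈ V | quality cell κ t U y z ≠ 0} * κ
      ≤ ∑ z ∈ V with quality cell κ t U y z ≠ 0, 2 * #{j ∈ U | y j ∈ cell z} :=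
        Finset.card_nsmul_le_sum _ _ _ hheavy
    _ ≤ ∑ z ∈ V, 2 * #{j ∈ U | y j ∈ cell z} :=
        Finset.sum_le_sum_of_subset (Finset.filter_subset _ _)
    _ = 2 * ∑ j ∈ U, #{z ∈ V | y j ∈ cell z} := by
        rw [← Finset.mul_sum]
        simp only [Finset.card_filter]
        rw [Finset.sum_comm]
    _ ≤ 2 * ∑ _ ∈ U, S := by gcongr; exact hcell.card_le _
    _ ≤ 200 * S * κ := by
        rw [Finset.sum_const, smul_eq_mul]
        calc 2 * (#U * S) ≤ 2 * (100 * κ * S) := by gcongr; exact hcard ▸ U.card_le_univ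
          _ = 200 * S * κ := by ring

theorem IsSearchTree.exists_quality_ge {S κ : ℕ} {V : Finset ℝ} {cell : ℝ → Set ℝ}
    (hcell : IsSearchTree S V cell) (hcard : Fintype.card ι = 100 * κ) (hκ : 0 < κ)
    {y : ι → ℝ} (hy : ∀ j, y j ∈ V) : ∃ z ∈ V, 3 * κ ≤ quality cell κ 0 Finset.univ y z := by
  classical
  have hne : (Finset.univ : Finset ι).Nonempty := by rw [← Finset.card_pos, Finset.card_univ]; omega
  obtain ⟨i, -, hbelow, habove⟩ := exists_median Finset.univ hne y
  obtain ⟨z, hz, hheavy, hbetween⟩ := hcell.exists_heavy (Finset.univ.val.map y) (4 * κ)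
    (by simp only [Multiset.card_map, Finset.card_val, Finset.card_univ]; omega) (y i) (hy i)
  have hcount (p : ℝ → Prop) [DecidablePred p] :
      ((Finset.univ.val.map y).filter p).card = #{j | p (y j)} := by
    rw [Multiset.filter_map, Multiset.card_map]
    rfl
  rw [hcount] at hheavy hbetween
  have hsplit (p p' : ℝ → Prop) (h : ∀ v, p v → p' v ∨ v ∈ Set.uIcc z (y i) \ {z}) :
      #{j | p (y j)} ≤ #{j | p' (y j)} + #{j | y j ∈ Set.uIcc z (y i) \ {z}} := by
    refine (Finset.card_le_card fun j hj => ?_).trans (Finset.card_union_le _ _)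
    simpa only [Finset.mem_union, Finset.mem_filter, Finset.mem_univ, true_and] using
      h (y j) (Finset.mem_filter.1 hj).2
  have hbelow' := hsplit (· ≤ y i) (· ≤ z) fun v hv => or_iff_not_imp_left.2 fun hvz =>
    ⟨Set.Icc_subset_uIcc ⟨(not_le.1 hvz).le, hv⟩, (not_le.1 hvz).ne'⟩
  have habove' := hsplit (y i ≤ ·) (z ≤ ·) fun v hv => or_iff_not_imp_left.2 fun hvz =>
    ⟨Set.Icc_subset_uIcc' ⟨hv, (not_le.1 hvz).le⟩, (not_le.1 hvz).ne⟩
  rw [Finset.card_univ] at hbelow habove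
  exact ⟨z, hz, by unfold quality; omega⟩

theorem exists_isStable_isInterior {S κ l : ℕ} {x W δ θ : ℝ≥0}
    (hcard : Fintype.card ι = 100 * κ) {V : Finset ℝ} (hV : #V < 2 ^ S) (hκ : 0 < κ)
    (hl : 2 * l ≤ κ) (hx : 1 ≤ x) (hW : 0 < W) (hθW : 200 * S * x ^ l ≤ θ * W) (hδ : δ ≤ 1)
    (hxδ : x ^ l + θ ≤ 1 + δ) :
    ∃ mech : (ι → ℝ) → PMF ℝ, IsStable l (1 + δ ^ 2 + θ : ℝ≥0) mech ∧
      ∀ y, (∀ j, y j ∈ V) → (mech y).toOuterMeasure {z | ¬ IsInterior (43 * κ) y z} ≤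
        (W / x ^ (3 * κ) : ℝ≥0) := by
  classical
  obtain ⟨cell, hcell⟩ := exists_isSearchTree S V hV
  refine ⟨fun y => response V x hW (quality cell κ 0 Finset.univ y), ?_, ?_⟩
  · rintro J rfl
    refine ⟨fun y => response V x hW (quality cell κ (#J) Jᶜ y), fun y y' hyy' => ?_, fun y => ?_⟩
    · simp only [quality_congr cell κ (#J) fun j hj => hyy' j (Finset.mem_compl.1 hj)]
    · exact sqDominated_response V hx hW (quality_univ_le cell κ J y)
        (hcell.card_quality_ne_zero_le hcard hκ hl Jᶜ y) (by exact_mod_cast hθW) hδ hxδ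
  · intro y hy
    obtain ⟨z, hz, hqz⟩ := hcell.exists_quality_ge hcard hκ hy
    refine le_trans (PMF.toOuterMeasure_mono _ fun v hv => ?_)
      (toOuterMeasure_response_le V hx hW (by omega) hz hqz)
    have hv : ¬ IsInterior (43 * κ) y v := hv.1
    simp only [IsInterior, Set.mem_ofPred_eq, quality] at hv ⊢
    omega

end StableMedian

namespace Transcript

variable {X : Type*}

theorem queries_append_some (h : Transcript X) (x : X) (z : ℝ) :
    Transcript.queries (h ++ [(x, some z)]) = h.queries + 1 := by
  simp [queries, List.countP_append]

theorem queries_append_none (h : Transcript X) (x : X) :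
    Transcript.queries (h ++ [(x, none)]) = h.queries := by
  simp [queries, List.countP_append]

theorem updates_append (h : Transcript X) (p : X × Option ℝ) :
    Transcript.updates (h ++ [p]) = h.updates ++ [p.1] := by
  simp [updates]

theorem length_updates (h : Transcript X) : h.updates.length = h.length := by
  simp [updates]

theorem queries_le_length (h : Transcript X) : h.queries ≤ h.length := List.countP_le_length

theorem AllAccurate.append {g : List X → ℝ} {α : ℝ} {h : Transcript X} (hh : h.AllAccurate g α)
    {p : X × Option ℝ} (hp : ∀ z, p.2 = some z → Accurate α (g (h.updates ++ [p.1])) z) :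
    Transcript.AllAccurate g α (h ++ [p]) := by
  intro i hi z hz
  rcases Nat.lt_or_ge i h.length with hlt | hge
  · rw [List.getElem_append_left hlt] at hz
    rw [List.take_append_of_le_length (by omega)]
    exact hh i hlt z hz
  · obtain rfl : i = h.length := by
      rw [List.length_append, List.length_singleton] at hi
      omega
    rw [List.getElem_append_right le_rfl] at hz
    simp only [Nat.sub_self, List.getElem_cons_zero] at hz
    rw [List.take_of_length_le (by simp), updates_append]
    exact hp z hz

end Transcript

section Pool

/-- A configuration of an algorithm that works with pools of samples from `R`: the samples in the
active and in the next pool, the lengths of the stream at which their preparation began, and the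
transcript. -/
structure Config (X R ι : Type*) where
  active : ι → R
  next : ι → R
  activeStart : ℕ
  nextStart : ℕ
  transcript : Transcript X

variable {X R ι : Type*}

/-- The configuration after a round that does not end an epoch. -/
def Config.push (c : Config X R ι) (p : X × Option ℝ) : Config X R ι :=
  { c with transcript := c.transcript ++ [p] }

/-- The next pool becomes active, and the preparation of the pool `ρ` begins. -/
def Config.rotate (c : Config X R ι) (ρ : ι → R) : Config X R ι :=
  ⟨c.next, ρ, c.nextStart, c.transcript.length, c.transcript⟩

/-- The preparation of both pools began in the past. -/
def Config.IsTimely (c : Config X R ι) : Prop :=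
  c.activeStart ≤ c.transcript.length ∧ c.nextStart ≤ c.transcript.length

theorem Config.IsTimely.push {c : Config X R ι} (hc : c.IsTimely) (p : X × Option ℝ) :
    (c.push p).IsTimely := by
  have hlen : c.transcript.length ≤ (c.push p).transcript.length := by simp [Config.push]
  exact ⟨hc.1.trans hlen, hc.2.trans hlen⟩

theorem Config.IsTimely.rotate {c : Config X R ι} (hc : c.IsTimely) (ρ : ι → R) :
    (c.rotate ρ).IsTimely :=
  ⟨hc.2, le_rfl⟩

variable [Fintype ι] [DecidableEq ι] [Fintype R]

/-- The end of a query round: after every `Q`-th query, the next pool becomes active and a new pool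
is drawn. -/
noncomputable def settle (μ : PMF R) (Q : ℕ) (c : Config X R ι) : PMF (Config X R ι) :=
  if c.transcript.queries % Q = 0 then (iid ι μ).map c.rotate else PMF.pure c

/-- A round in which the adversary makes the move `p` and queries are answered from the active pool
according to `ans`. -/
noncomputable def poolStep (μ : PMF R) (Q : ℕ) (ans : (ι → R) → Transcript X → X → PMF ℝ)
    (c : Config X R ι) (p : X × Bool) : PMF (Config X R ι) :=
  if p.2 then (ans c.active c.transcript p.1).bind fun z => settle μ Q (c.push (p.1, some z))
  else PMF.pure (c.push (p.1, none))

/-- The law of a configuration with newly drawn pools. -/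
noncomputable def freshConfig (ι : Type*) [Fintype ι] [DecidableEq ι] (μ : PMF R)
    (activeStart nextStart : ℕ) (h : Transcript X) : PMF (Config X R ι) :=
  (iid ι μ).bind fun ρ => (iid ι μ).map fun ρ' => ⟨ρ, ρ', activeStart, nextStart, h⟩

/-- The law of the configuration after a given number of rounds against the adversary `B`. -/
noncomputable def poolPlay (μ : PMF R) (Q : ℕ) (B : Adversary X)
    (ans : (ι → R) → Transcript X → X → PMF ℝ) : ℕ → PMF (Config X R ι)
  | 0 => freshConfig ι μ 0 0 []
  | n + 1 => (poolPlay μ Q B ans n).bind fun c => (B c.transcript).bind (poolStep μ Q ans c)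

/-- The joint law of the configuration after a given number of rounds and the next move of the
adversary. -/
noncomputable def poolPlayMove (μ : PMF R) (Q : ℕ) (B : Adversary X)
    (ans : (ι → R) → Transcript X → X → PMF ℝ) (n : ℕ) : PMF (Config X R ι × (X × Bool)) :=
  (poolPlay μ Q B ans n).bind fun c => (B c.transcript).map fun p => (c, p)

variable {μ : PMF R} {Q : ℕ} {B : Adversary X} {ans ans' : (ι → R) → Transcript X → X → PMF ℝ}

theorem poolPlay_succ (n : ℕ) : poolPlay μ Q B ans (n + 1) =
    (poolPlayMove μ Q B ans n).bind fun s => poolStep μ Q ans s.1 s.2 := by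
  simp only [poolPlay, poolPlayMove, PMF.bind_bind, PMF.bind_map, Function.comp_def]

theorem map_fst_poolPlayMove (n : ℕ) :
    (poolPlayMove μ Q B ans n).map Prod.fst = poolPlay μ Q B ans n := by
  simp only [poolPlayMove, PMF.map_bind, PMF.map_comp]
  exact (congrArg _ (funext fun c => PMF.map_const _ c)).trans (PMF.bind_pure _)

theorem transcript_of_mem_support_settle {c c' : Config X R ι} (hc' : c' ∈ (settle μ Q c).support) :
    c'.transcript = c.transcript := by
  rw [settle] at hc'
  split_ifs at hc'
  · obtain ⟨ρ, -, rfl⟩ := (PMF.mem_support_map_iff _ _ _).1 hc'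
    rfl
  · rw [(PMF.mem_support_pure_iff _ _).1 hc']

theorem transcript_of_mem_support_poolStep {c c' : Config X R ι} {p : X × Bool}
    (hc' : c' ∈ (poolStep μ Q ans c p).support) :
    ∃ o : Option ℝ, o.isSome = p.2 ∧ c'.transcript = c.transcript ++ [(p.1, o)] := by
  rw [poolStep] at hc'
  split_ifs at hc' with hp
  · obtain ⟨z, -, hc'⟩ := (PMF.mem_support_bind_iff _ _ _).1 hc'
    exact ⟨some z, hp.symm, transcript_of_mem_support_settle hc'⟩
  · rw [(PMF.mem_support_pure_iff _ _).1 hc']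
    exact ⟨none, (Bool.eq_false_iff.2 hp).symm, rfl⟩

theorem length_of_mem_support_poolPlay {n : ℕ} {c : Config X R ι}
    (hc : c ∈ (poolPlay μ Q B ans n).support) : c.transcript.length = n := by
  induction n generalizing c with
  | zero =>
    obtain ⟨ρ, -, hc⟩ := (PMF.mem_support_bind_iff _ _ _).1 hc
    obtain ⟨ρ', -, rfl⟩ := (PMF.mem_support_map_iff _ _ _).1 hc
    rfl
  | succ n ih =>
    obtain ⟨c₀, hc₀, hc⟩ := (PMF.mem_support_bind_iff _ _ _).1 hc
    obtain ⟨p, -, hc⟩ := (PMF.mem_support_bind_iff _ _ _).1 hc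
    obtain ⟨o, -, hc⟩ := transcript_of_mem_support_poolStep hc
    rw [hc, List.length_append, ih hc₀, List.length_singleton]

theorem isTimely_of_mem_support_settle {c c' : Config X R ι} (hc : c.IsTimely)
    (hc' : c' ∈ (settle μ Q c).support) : c'.IsTimely := by
  rw [settle] at hc'
  split_ifs at hc'
  · obtain ⟨ρ, -, rfl⟩ := (PMF.mem_support_map_iff _ _ _).1 hc'
    exact hc.rotate ρ
  · rwa [(PMF.mem_support_pure_iff _ _).1 hc']

theorem isTimely_of_mem_support_poolStep {c c' : Config X R ι} {p : X × Bool} (hc : c.IsTimely)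
    (hc' : c' ∈ (poolStep μ Q ans c p).support) : c'.IsTimely := by
  rw [poolStep] at hc'
  split_ifs at hc'
  · obtain ⟨z, -, hc'⟩ := (PMF.mem_support_bind_iff _ _ _).1 hc'
    exact isTimely_of_mem_support_settle (hc.push _) hc'
  · rw [(PMF.mem_support_pure_iff _ _).1 hc']
    exact hc.push _

theorem isTimely_of_mem_support_poolPlay {n : ℕ} {c : Config X R ι}
    (hc : c ∈ (poolPlay μ Q B ans n).support) : c.IsTimely := by
  induction n generalizing c with
  | zero =>
    obtain ⟨ρ, -, hc⟩ := (PMF.mem_support_bind_iff _ _ _).1 hc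
    obtain ⟨ρ', -, rfl⟩ := (PMF.mem_support_map_iff _ _ _).1 hc
    exact ⟨le_rfl, le_rfl⟩
  | succ n ih =>
    obtain ⟨c₀, hc₀, hc⟩ := (PMF.mem_support_bind_iff _ _ _).1 hc
    obtain ⟨p, -, hc⟩ := (PMF.mem_support_bind_iff _ _ _).1 hc
    exact isTimely_of_mem_support_poolStep (ih hc₀) hc

/-- The number of queries posed in epoch `e`, among the first `q` ones. -/
def epochQueries (Q e q : ℕ) : ℕ := min (q - e * Q) Q

theorem epochQueries_mono (Q e : ℕ) : Monotone (epochQueries Q e) := by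
  intro q q' h
  unfold epochQueries
  omega

theorem epochQueries_succ (hQ : 0 < Q) (q : ℕ) :
    epochQueries Q (q / Q) (q + 1) = epochQueries Q (q / Q) q + 1 := by
  have hle := Nat.div_mul_le_self q Q
  have hlt := Nat.lt_div_mul_add (a := q) hQ
  unfold epochQueries
  omega

theorem sqDominated_poolStep {a : ℝ≥0∞} (ha : 1 ≤ a) {c : Config X R ι} {p : X × Bool}
    (h : SqDominated a (ans c.active c.transcript p.1) (ans' c.active c.transcript p.1)) :
    SqDominated a (poolStep μ Q ans c p) (poolStep μ Q ans' c p) := by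
  unfold poolStep
  split_ifs
  · simpa only [mul_one] using h.bind fun z => SqDominated.refl (settle μ Q (c.push (p.1, some z)))
  · exact (SqDominated.refl _).mono ha

theorem pow_mul_expect_poolStep_sq_le (hQ : 0 < Q) {e : ℕ} {a : ℝ≥0∞} (ha : 1 ≤ a)
    (hsame : ∀ ρ h x, Transcript.queries h / Q ≠ e → ans ρ h x = ans' ρ h x)
    (hdom : ∀ ρ h x, Transcript.queries h / Q = e → SqDominated a (ans ρ h x) (ans' ρ h x))
    (c : Config X R ι) (p : X × Bool) (f : Config X R ι → ℝ≥0∞) :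
    a ^ epochQueries Q e c.transcript.queries * expect (poolStep μ Q ans c p) f ^ 2 ≤
      expect (poolStep μ Q ans' c p) fun c' =>
        a ^ epochQueries Q e c'.transcript.queries * f c' ^ 2 := by
  obtain ⟨b, hb, hab⟩ : ∃ b, SqDominated b (poolStep μ Q ans c p) (poolStep μ Q ans' c p) ∧
      ∀ c' ∈ (poolStep μ Q ans' c p).support, a ^ epochQueries Q e c.transcript.queries * b ≤
        a ^ epochQueries Q e c'.transcript.queries := by
    by_cases he : p.2 = true ∧ c.transcript.queries / Q = e
    · obtain ⟨hp, rfl⟩ := he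
      refine ⟨a, sqDominated_poolStep ha (hdom _ _ _ rfl), fun c' hc' => ?_⟩
      obtain ⟨o, ho, hc'⟩ := transcript_of_mem_support_poolStep hc'
      obtain ⟨z, rfl⟩ := Option.isSome_iff_exists.1 (ho.trans hp)
      rw [hc', Transcript.queries_append_some, epochQueries_succ hQ, pow_succ]
    · refine ⟨1, ?_, fun c' hc' => ?_⟩
      · have heq : poolStep μ Q ans c p = poolStep μ Q ans' c p := by
          unfold poolStep
          split_ifs with hp
          · rw [hsame _ _ _ fun h => he ⟨hp, h⟩]
          · rfl
        exact heq ▸ SqDominated.refl _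
      · obtain ⟨o, -, hc'⟩ := transcript_of_mem_support_poolStep hc'
        rw [mul_one, hc']
        refine pow_le_pow_right₀ ha (epochQueries_mono Q e ?_)
        exact List.countP_append.trans_ge le_self_add
  calc _ ≤ a ^ epochQueries Q e c.transcript.queries *
          (b * expect (poolStep μ Q ans' c p) fun c' => f c' ^ 2) := mul_le_mul_right (hb f) _
    _ = expect (poolStep μ Q ans' c p) fun c' =>
          a ^ epochQueries Q e c.transcript.queries * b * f c' ^ 2 := by
        rw [expect_const_mul, mul_assoc]
    _ ≤ _ := expect_mono_of_support fun c' hc' => mul_le_mul_left (hab c' hc') _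

theorem sqDominated_poolPlay (hQ : 0 < Q) {e : ℕ} {a : ℝ≥0∞} (ha : 1 ≤ a)
    (hsame : ∀ ρ h x, Transcript.queries h / Q ≠ e → ans ρ h x = ans' ρ h x)
    (hdom : ∀ ρ h x, Transcript.queries h / Q = e → SqDominated a (ans ρ h x) (ans' ρ h x))
    (n : ℕ) : SqDominated (a ^ Q) (poolPlay μ Q B ans n) (poolPlay μ Q B ans' n) := by
  suffices hweighted : ∀ f : Config X R ι → ℝ≥0∞, expect (poolPlay μ Q B ans n) f ^ 2 ≤
      expect (poolPlay μ Q B ans' n) fun c =>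
        a ^ epochQueries Q e c.transcript.queries * f c ^ 2 by
    refine fun f => (hweighted f).trans ?_
    rw [← expect_const_mul]
    exact expect_mono fun c => mul_le_mul_left (pow_le_pow_right₀ ha (min_le_right _ _)) _
  induction n with
  | zero =>
    intro f
    refine (SqDominated.refl _ f).trans ?_
    rw [one_mul]
    exact expect_mono fun c => le_mul_of_one_le_left' (one_le_pow₀ ha)
  | succ n ih =>
    intro f
    simp only [poolPlay, expect_bind]
    refine (ih _).trans (expect_mono fun c => ?_)
    have hmove := SqDominated.refl (B c.transcript) fun p => expect (poolStep μ Q ans c p) f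
    rw [one_mul] at hmove
    refine (mul_le_mul_right hmove _).trans ?_
    rw [← expect_const_mul]
    exact expect_mono fun p => pow_mul_expect_poolStep_sq_le hQ ha hsame hdom c p f

end Pool

section Resampling

variable {X R ι : Type*} [DecidableEq ι]

/-- Replace the samples in the next pool by `ρ'` and, during epoch `e`, those in the part `J` of the
active pool by the corresponding samples of `ρ`. -/
def Config.redraw (Q e : ℕ) (J : Finset ι) (ρ ρ' : ι → R) (c : Config X R ι) : Config X R ι :=
  { c with
    active := if c.transcript.queries / Q = e then J.piecewise ρ c.active else c.active
    next := ρ' }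

theorem redraw_redraw {Q e : ℕ} {J : Finset ι} (ρ ρ' ρ₁ ρ₁' : ι → R) (c : Config X R ι) :
    (c.redraw Q e J ρ₁ ρ₁').redraw Q e J ρ ρ' = c.redraw Q e J ρ ρ' := by
  by_cases h : c.transcript.queries / Q = e
  · simp only [Config.redraw, if_pos h, Finset.piecewise_idem_right]
  · simp only [Config.redraw, if_neg h]

theorem redraw_push {Q e : ℕ} {J : Finset ι} {ρ ρ' : ι → R} {c : Config X R ι} {p : X × Option ℝ}
    (h : (c.push p).transcript.queries / Q = c.transcript.queries / Q) :
    (c.redraw Q e J ρ ρ').push p = (c.push p).redraw Q e J ρ ρ' := by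
  simp only [Config.redraw, h]
  rfl

variable [Fintype ι] [Fintype R]

/-- Resample the next pool and, during epoch `e`, the part `J` of the active pool. -/
noncomputable def resample (μ : PMF R) (Q e : ℕ) (J : Finset ι) (c : Config X R ι) :
    PMF (Config X R ι) :=
  (iid ι μ).bind fun ρ' => (iid ι μ).map fun ρ => c.redraw Q e J ρ ρ'

/-- The law `P` is invariant under resampling: conditionally on the rest of the configuration, the
samples in the next pool, and in the part `J` of the active pool, are still independent samples
from `μ`. -/
def IsResampled (μ : PMF R) (Q e : ℕ) (J : Finset ι) (P : PMF (Config X R ι)) : Prop :=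
  P.bind (resample μ Q e J) = P

variable {μ : PMF R} {Q e : ℕ} {J : Finset ι} {B : Adversary X}
  {ans : (ι → R) → Transcript X → X → PMF ℝ}

theorem IsResampled.bind {α : Type*} (P : PMF α) {K : α → PMF (Config X R ι)}
    (hK : ∀ a, IsResampled μ Q e J (K a)) : IsResampled μ Q e J (P.bind K) := by
  rw [IsResampled, PMF.bind_bind]
  exact congrArg P.bind (funext hK)

theorem isResampled_resample (c : Config X R ι) :
    IsResampled μ Q e J (resample μ Q e J c) := by
  simp only [IsResampled, resample, PMF.bind_bind, PMF.bind_map, Function.comp_def, redraw_redraw,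
    PMF.bind_const]

theorem isResampled_freshConfig (activeStart nextStart : ℕ) (h : Transcript X) :
    IsResampled μ Q e J (freshConfig ι μ activeStart nextStart h) := by
  simp only [IsResampled, freshConfig, resample, Config.redraw, PMF.bind_bind, PMF.bind_map,
    Function.comp_def, PMF.bind_const]
  by_cases he : h.queries / Q = e
  · have hpiecewise := congrArg (fun P => P.bind fun ρ => (iid ι μ).bind fun ρ' =>
      PMF.pure (Config.mk ρ ρ' activeStart nextStart h)) (iid_bind_map_piecewise (ι := ι) μ J)
    simp only [PMF.bind_bind, PMF.bind_map, Function.comp_def] at hpiecewise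
    simp only [if_pos he, ← PMF.bind_pure_comp, Function.comp_def, ← hpiecewise]
    exact congrArg _ (funext fun ρ => PMF.bind_comm _ _ _)
  · simp only [if_neg he, ← PMF.bind_pure_comp, Function.comp_def, PMF.bind_const]

theorem resample_bind_comm (c : Config X R ι) {α β : Type*} (P : Transcript X → PMF α)
    (K : Config X R ι → α → PMF β) :
    ((resample μ Q e J c).bind fun c' => (P c'.transcript).bind (K c')) =
      (P c.transcript).bind fun a => (resample μ Q e J c).bind fun c' => K c' a := by
  rw [PMF.bind_comm]
  simp only [resample, PMF.bind_bind, PMF.bind_map, Function.comp_def]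
  rfl

theorem isResampled_resample_bind_settle (c : Config X R ι) (x : X) (z : ℝ) :
    IsResampled μ Q e J ((resample μ Q e J c).bind fun c' => settle μ Q (c'.push (x, some z))) := by
  set h := c.transcript ++ [(x, some z)] with hh
  by_cases hrot : Transcript.queries h % Q = 0
  · suffices hfresh : ((resample μ Q e J c).bind fun c' => settle μ Q (c'.push (x, some z))) =
        freshConfig ι μ c.nextStart h.length h from hfresh ▸ isResampled_freshConfig _ _ _
    have hrotate (c : Config X R ι) : c.rotate =
        fun ρ => ⟨c.next, ρ, c.nextStart, c.transcript.length, c.transcript⟩ := rfl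
    simp only [settle, resample, freshConfig, Config.redraw, Config.push, hrotate, PMF.bind_bind,
      PMF.bind_map, Function.comp_def, ← hh, if_pos hrot, PMF.bind_const]
  · suffices hpush : ((resample μ Q e J c).bind fun c' => settle μ Q (c'.push (x, some z))) =
        resample μ Q e J (c.push (x, some z)) from hpush ▸ isResampled_resample _
    have hepoch : (c.push (x, some z)).transcript.queries / Q = c.transcript.queries / Q := by
      rw [hh, Transcript.queries_append_some] at hrot
      rw [Config.push, Transcript.queries_append_some, Nat.succ_div,
        if_neg fun hd => hrot (Nat.mod_eq_zero_of_dvd hd), add_zero]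
    simp only [resample, PMF.bind_bind, PMF.bind_map, ← redraw_push hepoch]
    exact congrArg _ (funext fun ρ' =>
      (congrArg _ (funext fun ρ => if_neg hrot)).trans (PMF.bind_pure_comp _ _))

theorem isResampled_resample_bind_poolStep
    (hans : ∀ ρ ρ' h x, Transcript.queries h / Q = e → (∀ j ∉ J, ρ j = ρ' j) →
      ans ρ h x = ans ρ' h x) (c : Config X R ι) (p : X × Bool) :
    IsResampled μ Q e J ((resample μ Q e J c).bind fun c' => poolStep μ Q ans c' p) := by
  by_cases hp : p.2
  · have hans' (c') (hc' : c' ∈ (resample μ Q e J c).support) :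
        ans c'.active c'.transcript p.1 = ans c.active c.transcript p.1 := by
      obtain ⟨ρ', -, hc'⟩ := (PMF.mem_support_bind_iff _ _ _).1 hc'
      obtain ⟨ρ, -, rfl⟩ := (PMF.mem_support_map_iff _ _ _).1 hc'
      simp only [Config.redraw]
      split_ifs with he
      · exact hans _ _ _ _ he fun j hj => Finset.piecewise_eq_of_notMem _ _ _ hj
      · rfl
    simp only [poolStep, if_pos hp]
    rw [bind_congr_support fun c' hc' => by rw [hans' c' hc'], PMF.bind_comm]
    exact IsResampled.bind _ fun z => isResampled_resample_bind_settle c p.1 z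
  · have hepoch : (c.push (p.1, none)).transcript.queries / Q = c.transcript.queries / Q := by
      rw [Config.push, Transcript.queries_append_none]
    simp only [poolStep, if_neg hp, resample, PMF.bind_bind, PMF.bind_map, Function.comp_def,
      redraw_push hepoch]
    exact isResampled_resample (c.push (p.1, none))

theorem isResampled_poolPlay
    (hans : ∀ ρ ρ' h x, Transcript.queries h / Q = e → (∀ j ∉ J, ρ j = ρ' j) →
      ans ρ h x = ans ρ' h x) (n : ℕ) : IsResampled μ Q e J (poolPlay μ Q B ans n) := by
  induction n with
  | zero => exact isResampled_freshConfig 0 0 []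
  | succ n ih =>
    have hcomm (c : Config X R ι) := resample_bind_comm (μ := μ) (Q := Q) (e := e) (J := J) c B
      (poolStep μ Q ans)
    rw [poolPlay, ← ih, PMF.bind_bind, funext hcomm]
    exact IsResampled.bind _ fun c => IsResampled.bind _ fun p =>
      isResampled_resample_bind_poolStep hans c p

theorem toOuterMeasure_poolPlayMove_forall_bad_le
    (hans : ∀ ρ ρ' h x, Transcript.queries h / Q = e → (∀ j ∉ J, ρ j = ρ' j) →
      ans ρ h x = ans ρ' h x) {bad : R → List X → Prop} {n : ℕ} {δ : ℝ≥0∞}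
    (hbad : ∀ x, x.length = n + 1 → μ.toOuterMeasure {r | bad r x} ≤ δ) :
    (poolPlayMove μ Q B ans n).toOuterMeasure {s | s.1.transcript.queries / Q = e ∧
      ∀ j ∈ J, bad (s.1.active j) (s.1.transcript.updates ++ [s.2.1])} ≤ δ ^ #J := by
  rw [poolPlayMove, ← isResampled_poolPlay hans n, PMF.bind_bind]
  refine toOuterMeasure_bind_le fun c hc => ?_
  have hcomm := resample_bind_comm (μ := μ) (Q := Q) (e := e) (J := J) c B
    fun c' p => PMF.pure (c', p)
  simp only [← PMF.bind_pure_comp, Function.comp_def]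
  rw [hcomm]
  refine toOuterMeasure_bind_le fun p _ => ?_
  simp only [resample, PMF.bind_bind, PMF.bind_map, Function.comp_def]
  refine toOuterMeasure_bind_le fun ρ' _ => ?_
  have hx : (c.transcript.updates ++ [p.1]).length = n + 1 := by
    rw [List.length_append, Transcript.length_updates, length_of_mem_support_poolPlay hc,
      List.length_singleton]
  refine le_trans ?_ (pow_le_pow_left' (hbad _ hx) _)
  change ((iid ι μ).map fun ρ => (c.redraw Q e J ρ ρ', p)).toOuterMeasure _ ≤ _
  rw [← toOuterMeasure_iid_forall_mem, PMF.toOuterMeasure_map_apply]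
  refine PMF.toOuterMeasure_mono _ fun ρ ⟨⟨he, hρ⟩, _⟩ j hj => ?_
  have hρj := hρ j hj
  simp only [Config.redraw] at he hρj
  rwa [if_pos he, Finset.piecewise_eq_of_mem _ _ _ hj] at hρj

end Resampling

section Generalization

theorem Accurate.of_le_of_le {α y z₁ z₂ z : ℝ} (h₁ : Accurate α y z₁) (h₂ : Accurate α y z₂)
    (hz₁ : z₁ ≤ z) (hz₂ : z ≤ z₂) : Accurate α y z := by
  unfold Accurate at *
  rw [abs_le] at *
  constructor <;> linarith [h₁.1, h₂.2]

open scoped Classical in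
theorem IsInterior.accurate {ι : Type*} [Fintype ι] {N : ℕ} {y : ι → ℝ} {z : ℝ}
    (hz : IsInterior N y z) {α v : ℝ}
    (hbad : #{j | ¬ Accurate α v (y j)} ≤ N) : Accurate α v z := by
  obtain ⟨i, hi, hi'⟩ := Finset.exists_mem_notMem_of_card_lt_card (hbad.trans_lt hz.1)
  obtain ⟨j, hj, hj'⟩ := Finset.exists_mem_notMem_of_card_lt_card (hbad.trans_lt hz.2)
  simp only [Finset.mem_filter_univ, not_not] at hi hi' hj hj'
  exact hi'.of_le_of_le hj' hi hj

theorem choose_le_sum_powersetCard {ι : Type*} {U : Finset ι} {s : Finset ι} (hs : s ⊆ U)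
    {l N : ℕ} (hN : N ≤ #s) [∀ J : Finset ι, Decidable (J ⊆ s)] :
    (N.choose l : ℝ≥0∞) ≤ ∑ J ∈ U.powersetCard l, if J ⊆ s then 1 else 0 := by
  have hsub : s.powersetCard l ⊆ (U.powersetCard l).filter (· ⊆ s) := fun J hJ => by
    rw [Finset.mem_powersetCard] at hJ
    exact Finset.mem_filter.2 ⟨Finset.mem_powersetCard.2 ⟨hJ.1.trans hs, hJ.2⟩, hJ.1⟩
  rw [Finset.sum_boole]
  refine Nat.cast_le.2 ((Nat.choose_le_choose l hN).trans ?_)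
  rw [← Finset.card_powersetCard]
  exact Finset.card_le_card hsub

open scoped Classical in
theorem toOuterMeasure_lt_card_mul_choose_le {Ω ι : Type*} [Fintype ι] (P : PMF Ω)
    {S : Ω → Prop} {bad : Ω → ι → Prop} {l N : ℕ} {b : ℝ≥0∞}
    (h : ∀ J : Finset ι, #J = l → P.toOuterMeasure {ω | S ω ∧ ∀ j ∈ J, bad ω j} ≤ b) :
    P.toOuterMeasure {ω | S ω ∧ N < #{j | bad ω j}} * N.choose l ≤
      (Fintype.card ι).choose l * b := by
  calc P.toOuterMeasure {ω | S ω ∧ N < #{j | bad ω j}} * N.choose l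
      = expect P fun ω => N.choose l * {ω | S ω ∧ N < #{j | bad ω j}}.indicator 1 ω := by
        rw [toOuterMeasure_eq_expect, expect_const_mul, mul_comm]
    _ ≤ expect P fun ω => ∑ J ∈ Finset.univ.powersetCard l,
          {ω | S ω ∧ ∀ j ∈ J, bad ω j}.indicator 1 ω := by
        refine expect_mono fun ω => ?_
        by_cases hω : S ω ∧ N < #{j | bad ω j}
        · rw [Set.indicator_of_mem (by exact hω), Pi.one_apply, mul_one]
          refine (choose_le_sum_powersetCard (Finset.subset_univ _) hω.2.le).trans_eq ?_
          refine Finset.sum_congr rfl fun J _ => ?_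
          simp only [Set.indicator_apply, Set.mem_ofPred_eq, hω.1, true_and, Pi.one_apply,
            Finset.subset_iff, Finset.mem_filter_univ]
        · rw [Set.indicator_of_notMem (by exact hω), mul_zero]
          exact zero_le
    _ = ∑ J ∈ Finset.univ.powersetCard l, P.toOuterMeasure {ω | S ω ∧ ∀ j ∈ J, bad ω j} := by
        rw [expect_finset_sum]
        exact Finset.sum_congr rfl fun J _ => (toOuterMeasure_eq_expect _ _).symm
    _ ≤ ∑ _J ∈ (Finset.univ : Finset ι).powersetCard l, b :=
        Finset.sum_le_sum fun J hJ => h J (Finset.mem_powersetCard.1 hJ).2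
    _ = (Fintype.card ι).choose l * b := by
        rw [Finset.sum_const, Finset.card_powersetCard, Finset.card_univ, nsmul_eq_mul]

variable {X R ι : Type*}

/-- Answer a query by applying `mech` to the values `val r x` of the samples `r` in the active
pool on the stream `x`. -/
def poolAnswer (mech : (ι → ℝ) → PMF ℝ) (val : R → List X → ℝ) (ρ : ι → R) (h : Transcript X)
    (x : X) : PMF ℝ :=
  mech fun j => val (ρ j) (h.updates ++ [x])

variable [Fintype ι] [DecidableEq ι] [Fintype R] {μ : PMF R} {Q n : ℕ} {B : Adversary X}
  {mech : (ι → ℝ) → PMF ℝ} {val : R → List X → ℝ} {bad : R → List X → Prop}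
  {l N : ℕ} {a δ b D τ : ℝ≥0∞}

theorem toOuterMeasure_poolAnswer_forall_bad_sq_le (hQ : 0 < Q) (ha : 1 ≤ a)
    (hmech : IsStable l a mech)
    (hbad : ∀ x, x.length = n + 1 → μ.toOuterMeasure {r | bad r x} ≤ δ)
    (e : ℕ) {J : Finset ι} (hJ : #J = l) :
    (poolPlayMove μ Q B (poolAnswer mech val) n).toOuterMeasure
      {s | s.1.transcript.queries / Q = e ∧
        ∀ j ∈ J, bad (s.1.active j) (s.1.transcript.updates ++ [s.2.1])} ^ 2 ≤ a ^ Q * δ ^ l := by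
  obtain ⟨mech', hindep, hdom⟩ := hmech J hJ
  let ans' (ρ : ι → R) (h : Transcript X) : X → PMF ℝ :=
    if h.queries / Q = e then poolAnswer mech' val ρ h else poolAnswer mech val ρ h
  have hplay : SqDominated (a ^ Q) (poolPlay μ Q B (poolAnswer mech val) n)
      (poolPlay μ Q B ans' n) := by
    refine sqDominated_poolPlay (e := e) hQ ha (fun ρ h x he => ?_) (fun ρ h x he => ?_) n
    · simp only [ans', if_neg he]
    · simp only [ans', if_pos he]
      exact hdom _
  have hmove := hplay.bind fun c => SqDominated.refl ((B c.transcript).map fun p => (c, p))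
  rw [mul_one] at hmove
  refine (hmove.toOuterMeasure_sq_le _).trans (mul_le_mul_right ?_ _)
  rw [← hJ]
  refine toOuterMeasure_poolPlayMove_forall_bad_le (fun ρ ρ' h x he hρ => ?_) hbad
  simp only [ans', if_pos he]
  exact hindep _ _ fun j hj => by rw [hρ j hj]

open scoped Classical in
theorem toOuterMeasure_poolAnswer_many_bad_le (hQ : 0 < Q) (ha : 1 ≤ a)
    (hmech : IsStable l a mech)
    (hbad : ∀ x, x.length = n + 1 → μ.toOuterMeasure {r | bad r x} ≤ δ)
    (hlN : l ≤ N) (hb : a ^ Q * δ ^ l ≤ b ^ 2)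
    (hD : (Fintype.card ι).choose l * b ≤ D * N.choose l) :
    (poolPlayMove μ Q B (poolAnswer mech val) n).toOuterMeasure
      {s | N < #{j | bad (s.1.active j) (s.1.transcript.updates ++ [s.2.1])}} ≤ (n + 1) * D := by
  set P := poolPlayMove μ Q B (poolAnswer mech val) n
  set many : ℕ → Set (Config X R ι × (X × Bool)) := fun e => {s | s.1.transcript.queries / Q = e ∧
    N < #{j | bad (s.1.active j) (s.1.transcript.updates ++ [s.2.1])}}
  have hepoch (e : ℕ) : P.toOuterMeasure (many e) ≤ D := by
    have hpos : (N.choose l : ℝ≥0∞) ≠ 0 := Nat.cast_ne_zero.2 (Nat.choose_pos hlN).ne'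
    refine (ENNReal.mul_le_mul_iff_left hpos (ENNReal.natCast_ne_top _)).1 (le_trans ?_ hD)
    refine toOuterMeasure_lt_card_mul_choose_le P fun J hJ => ?_
    exact (ENNReal.pow_le_pow_left_iff two_ne_zero).1 <|
      (toOuterMeasure_poolAnswer_forall_bad_sq_le hQ ha hmech hbad e hJ).trans hb
  calc P.toOuterMeasure _
      ≤ P.toOuterMeasure (⋃ e ∈ Finset.range (n + 1), many e) := by
        refine PMF.toOuterMeasure_mono _ fun s ⟨hs, hsupp⟩ => ?_
        obtain ⟨c, hc, hs'⟩ := (PMF.mem_support_bind_iff _ _ _).1 hsupp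
        obtain ⟨p, -, rfl⟩ := (PMF.mem_support_map_iff _ _ _).1 hs'
        have hlen : c.transcript.queries / Q ≤ n := (Nat.div_le_self _ _).trans <|
          c.transcript.queries_le_length.trans_eq (length_of_mem_support_poolPlay hc)
        exact Set.mem_biUnion (Finset.mem_range.2 (Nat.lt_succ_of_le hlen)) ⟨rfl, hs⟩
    _ ≤ ∑ e ∈ Finset.range (n + 1), P.toOuterMeasure (many e) :=
        MeasureTheory.measure_biUnion_finset_le _ _
    _ ≤ ∑ _e ∈ Finset.range (n + 1), D := Finset.sum_le_sum fun e _ => hepoch e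
    _ = (n + 1) * D := by
        rw [Finset.sum_const, Finset.card_range, nsmul_eq_mul, Nat.cast_add_one]

variable {g : List X → ℝ} {α : ℝ}

open scoped Classical in
theorem toOuterMeasure_poolStep_not_allAccurate_le {V : Set ℝ} (hval : ∀ r x, val r x ∈ V)
    (hinterior : ∀ y, (∀ j, y j ∈ V) → (mech y).toOuterMeasure {z | ¬ IsInterior N y z} ≤ τ)
    {c : Config X R ι} {p : X × Bool} (hc : c.transcript.AllAccurate g α)
    (hfew : #{j | ¬ Accurate α (g (c.transcript.updates ++ [p.1]))
      (val (c.active j) (c.transcript.updates ++ [p.1]))} ≤ N) :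
    (poolStep μ Q (poolAnswer mech val) c p).toOuterMeasure
      {c' | ¬ c'.transcript.AllAccurate g α} ≤ τ := by
  unfold poolStep
  split_ifs
  · rw [← add_zero τ]
    refine (toOuterMeasure_bind_le_add fun z _ hz => ?_).trans
      (add_le_add_left (hinterior _ fun j => hval _ _) 0)
    refine ((PMF.toOuterMeasure_apply_eq_zero_iff _ _).2 ?_).le
    refine Set.disjoint_left.2 fun c' hc' => not_not.2 ?_
    rw [transcript_of_mem_support_settle hc']
    refine hc.append fun z' hz' => ?_
    obtain rfl : z = z' := Option.some.inj hz'
    exact (not_not.1 hz).accurate hfew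
  · refine (((PMF.toOuterMeasure_apply_eq_zero_iff _ _).2 ?_).le).trans zero_le
    refine Set.disjoint_left.2 fun c' hc' => not_not.2 ?_
    rw [(PMF.mem_support_pure_iff _ _).1 hc']
    exact hc.append fun z hz => by cases hz

theorem toOuterMeasure_poolPlay_not_allAccurate_le {V : Set ℝ} {m : ℕ} (hQ : 0 < Q) (ha : 1 ≤ a)
    (hmech : IsStable l a mech) (hval : ∀ r x, val r x ∈ V)
    (hinterior : ∀ y, (∀ j, y j ∈ V) → (mech y).toOuterMeasure {z | ¬ IsInterior N y z} ≤ τ)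
    (hbad : ∀ x, x ≠ [] → x.length ≤ m →
      μ.toOuterMeasure {r | ¬ Accurate α (g x) (val r x)} ≤ δ)
    (hlN : l ≤ N) (hb : a ^ Q * δ ^ l ≤ b ^ 2)
    (hD : (Fintype.card ι).choose l * b ≤ D * N.choose l) (hn : n ≤ m) :
    (poolPlay μ Q B (poolAnswer mech val) n).toOuterMeasure
      {c | ¬ c.transcript.AllAccurate g α} ≤ n * (m * D + τ) := by
  classical
  induction n with
  | zero =>
    rw [Nat.cast_zero, zero_mul]
    refine ((PMF.toOuterMeasure_apply_eq_zero_iff _ _).2 ?_).le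
    refine Set.disjoint_left.2 fun c hc => not_not.2 fun i hi => ?_
    exact absurd (length_of_mem_support_poolPlay hc ▸ hi) i.not_lt_zero
  | succ n ih =>
    set P := poolPlayMove μ Q B (poolAnswer mech val) n
    have hpast : P.toOuterMeasure {s | ¬ s.1.transcript.AllAccurate g α} ≤ n * (m * D + τ) := by
      refine le_trans ?_ (ih (by omega))
      rw [← map_fst_poolPlayMove, PMF.toOuterMeasure_map_apply]
      rfl
    have hmany := toOuterMeasure_poolAnswer_many_bad_le (B := B) (val := val) hQ ha hmech
      (fun x hx => hbad x (List.ne_nil_of_length_pos (by omega)) (hx.trans_le hn)) hlN hb hD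
    rw [poolPlay_succ]
    refine (toOuterMeasure_bind_le_add fun s _ hs => ?_).trans <| (add_le_add_left
      ((MeasureTheory.measure_union_le _ _).trans (add_le_add hpast hmany)) τ).trans ?_
    · obtain ⟨hacc, hfew⟩ := not_or.1 hs
      exact toOuterMeasure_poolStep_not_allAccurate_le hval hinterior (not_not.1 hacc)
        (by convert Nat.le_of_not_lt hfew)
    · have hnm : ((n : ℝ≥0∞) + 1) * D ≤ m * D := mul_le_mul_left (by exact_mod_cast hn) D
      rw [Nat.cast_add_one, add_assoc, add_one_mul (n : ℝ≥0∞) (m * D + τ)]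
      exact add_le_add_right (add_le_add_left hnm τ) _

end Generalization

section Simulation

variable {X : Type*}

theorem ASAAlgorithm.round_eq_map {R ι : Type*} [Fintype ι] [DecidableEq ι] [Fintype R]
    {A : ASAAlgorithm X} {μ : PMF R} {Q η : ℕ} {B : Adversary X}
    {ans : (ι → R) → Transcript X → X → PMF ℝ} {S : Config X R ι → A.State} {c : Config X R ι}
    (hupdate : ∀ x, A.update (S c) x = PMF.pure (S (c.push (x, none))))
    (hanswer : ∀ x, A.answer (S (c.push (x, none))) =
      (ans c.active c.transcript x).map fun z => (z, S (c.push (x, none))))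
    (hskip : ∀ x z, ¬η ∣ c.transcript.queries + 1 →
      PMF.pure (S (c.push (x, none))) = (settle μ Q (c.push (x, some z))).map S)
    (hreceive : ∀ x z, η ∣ c.transcript.queries + 1 →
      A.receive (S (c.push (x, none)))
          (A.predicate (S (c.push (x, none))) (c.transcript.updates ++ [x])) =
        (settle μ Q (c.push (x, some z))).map S) :
    A.round η B (S c, c.transcript) =
      ((B c.transcript).bind (poolStep μ Q ans c)).map fun c' => (S c', c'.transcript) := by
  have hsettle (x : X) (z : ℝ) : (settle μ Q (c.push (x, some z))).map
      (fun c' => (S c', c'.transcript)) =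
      ((settle μ Q (c.push (x, some z))).map S).map
        fun τ => (τ, c.transcript ++ [(x, some z)]) := by
    rw [PMF.map_comp]
    exact map_congr_support fun c' hc' => by rw [transcript_of_mem_support_settle hc']; rfl
  rw [ASAAlgorithm.round, PMF.map_bind]
  refine congrArg _ (funext fun ⟨x, q⟩ => ?_)
  rw [hupdate, PMF.pure_bind, poolStep]
  cases q
  · simp only [Bool.false_eq_true, if_false, PMF.pure_map, Config.push]
  simp only [if_true, hanswer, PMF.bind_map, PMF.map_bind, hsettle,
    Function.comp_def, Transcript.queries_append_some, Transcript.updates_append]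
  refine congrArg _ (funext fun z => ?_)
  split_ifs with hmod
  · rw [hreceive x z (Nat.dvd_of_mod_eq_zero hmod)]
  · rw [← hskip x z (hmod ∘ Nat.mod_eq_zero_of_dvd), PMF.pure_map]

/-- The stream `x` with a query in every round. -/
def queried (x : List X) : List (X × Bool) := x.map fun a => (a, true)

theorem queried_append (x y : List X) : queried (x ++ y) = queried x ++ queried y :=
  List.map_append

/-- The memory of the robust algorithm. It holds the samples of both pools. The run of a sample in
the active pool is split into a prefix, of which only the encoded vector is known, and a suffix; of
the runs of the samples in the next pool only the suffix is known so far, and the advice bits, of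
which `adviceCount` are already known, are to describe the vectors of the prefix, of length
`nextStart`. -/
structure SegmentedAlgorithm.PoolMemory (A : SegmentedAlgorithm X) (k b m : ℕ) where
  active : Fin k → A.SR
  activePrefix : Fin k → A.SV
  activeSuffix : Fin k → A.SV × A.SC
  next : Fin k → A.SR
  nextSuffix : Fin k → A.SV × A.SC
  advice : Fin (k * b) → Bool
  nextStart : Fin (m + 1)
  length : Fin (m + 1)
  adviceCount : Fin (k * b)

namespace SegmentedAlgorithm

variable {A : SegmentedAlgorithm X} {k b m η : ℕ}

/-- The memory of the robust algorithm as a product, which makes its states easy to count. -/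
def PoolMemory.equivProd (A : SegmentedAlgorithm X) (k b m : ℕ) : A.PoolMemory k b m ≃
    (Fin k → A.SR) × (Fin k → A.SV) × (Fin k → A.SV × A.SC) × (Fin k → A.SR) ×
      (Fin k → A.SV × A.SC) × (Fin (k * b) → Bool) × Fin (m + 1) × Fin (m + 1) × Fin (k * b) where
  toFun σ := ⟨σ.active, σ.activePrefix, σ.activeSuffix, σ.next, σ.nextSuffix, σ.advice,
    σ.nextStart, σ.length, σ.adviceCount⟩
  invFun t := ⟨t.1, t.2.1, t.2.2.1, t.2.2.2.1, t.2.2.2.2.1, t.2.2.2.2.2.1, t.2.2.2.2.2.2.1,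
    t.2.2.2.2.2.2.2.1, t.2.2.2.2.2.2.2.2⟩

instance : Fintype (A.PoolMemory k b m) := Fintype.ofEquiv _ (PoolMemory.equivProd A k b m).symm

/-- The `n`-th advice bit: the encodings, by `b` bits each, of the state vectors of the samples `ρ`
on the stream `x` are enumerated one after the other. -/
def adviceBit (A : SegmentedAlgorithm X) (enc : A.SV → Fin b → Bool) (ρ : Fin k → A.SR)
    (x : List X) (n : Fin (k * b)) : Bool :=
  enc (A.run (ρ (finProdFinEquiv.symm n).1) (queried x)).1 (finProdFinEquiv.symm n).2

variable [NeZero (k * b)]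

/-- The content of the memory of the robust algorithm in a given configuration. -/
def snapshot (A : SegmentedAlgorithm X) (m η : ℕ) (enc : A.SV → Fin b → Bool)
    (c : Config X A.SR (Fin k)) : A.PoolMemory k b m where
  active := c.active
  activePrefix j := (A.run (c.active j) (queried (c.transcript.updates.take c.activeStart))).1
  activeSuffix j := A.run (c.active j) (queried (c.transcript.updates.drop c.activeStart))
  next := c.next
  nextSuffix j := A.run (c.next j) (queried (c.transcript.updates.drop c.nextStart))
  advice n := decide (n < Fin.ofNat _ (c.transcript.queries / η)) &&
    A.adviceBit enc c.next (c.transcript.updates.take c.nextStart) n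
  nextStart := Fin.ofNat _ c.nextStart
  length := Fin.ofNat _ c.transcript.length
  adviceCount := Fin.ofNat _ (c.transcript.queries / η)

/-- The robust algorithm. It answers queries by applying `mech` to the responses of the samples in
the active pool, and requests the state vectors of the next pool, encoded by `enc`, bit by bit. -/
noncomputable def poolAlgorithm (A : SegmentedAlgorithm X) (m η : ℕ) (mech : (Fin k → ℝ) → PMF ℝ)
    (enc : A.SV → Fin b → Bool) (dec : (Fin b → Bool) → A.SV) : ASAAlgorithm X where
  State := A.PoolMemory k b m
  init := (freshConfig (Fin k) A.coins 0 0 []).map (A.snapshot m η enc)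
  update σ x := PMF.pure
    { σ with
      activeSuffix := fun j => A.update (σ.active j) (σ.activeSuffix j) (x, true)
      nextSuffix := fun j => A.update (σ.next j) (σ.nextSuffix j) (x, true)
      length := σ.length + 1 }
  answer σ := (mech fun j => A.respond (σ.active j)
    (A.vec (σ.activePrefix j) + A.vec (σ.activeSuffix j).1)).map fun z => (z, σ)
  predicate σ x := A.adviceBit enc σ.next (x.take σ.nextStart) σ.adviceCount
  receive σ a :=
    if σ.adviceCount + 1 = 0 then
      (iid (Fin k) A.coins).map fun ρ =>
        { active := σ.next
          activePrefix := fun j => dec fun i =>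
            Function.update σ.advice σ.adviceCount a (finProdFinEquiv (j, i))
          activeSuffix := σ.nextSuffix
          next := ρ
          nextSuffix := fun j => (A.initV (ρ j), A.initC (ρ j))
          advice := fun _ => false
          nextStart := σ.length
          length := σ.length
          adviceCount := 0 }
    else PMF.pure
      { σ with
        advice := Function.update σ.advice σ.adviceCount a
        adviceCount := σ.adviceCount + 1 }

variable {mech : (Fin k → ℝ) → PMF ℝ} {enc : A.SV → Fin b → Bool} {dec : (Fin b → Bool) → A.SV}
  {c : Config X A.SR (Fin k)}

theorem run_queried_append_singleton (r : A.SR) (x : List X) (a : X) :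
    A.run r (queried (x ++ [a])) = A.update r (A.run r (queried x)) (a, true) := by
  rw [queried_append, run, List.foldl_append]
  rfl

theorem finOfNat_add_one {T : ℕ} [NeZero T] (n : ℕ) :
    Fin.ofNat T (n + 1) = Fin.ofNat T n + 1 := by
  ext
  simp [Fin.val_add]

theorem finOfNat_eq_zero_iff {T : ℕ} [NeZero T] (n : ℕ) : Fin.ofNat T n = 0 ↔ n % T = 0 := by
  rw [Fin.ext_iff]
  rfl

theorem fin_le_of_add_one_eq_zero {T : ℕ} [NeZero T] {t : Fin T} (ht : t + 1 = 0) (n : Fin T) :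
    n ≤ t := by
  have hval := congrArg Fin.val ht
  rw [Fin.val_add, Fin.val_one', Nat.add_mod_mod, Fin.val_zero] at hval
  rcases (show (t : ℕ) + 1 ≤ T from t.2).lt_or_eq with hlt | heq
  · rw [Nat.mod_eq_of_lt hlt] at hval
    omega
  · have := n.2
    rw [Fin.le_def]
    omega

theorem fin_lt_add_one_iff {T : ℕ} [NeZero T] {t : Fin T} (ht : t + 1 ≠ 0) (n : Fin T) :
    n < t + 1 ↔ n ≤ t := by
  have hval := Fin.val_add t 1
  rw [Fin.val_one', Nat.add_mod_mod] at hval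
  rcases (show (t : ℕ) + 1 ≤ T from t.2).lt_or_eq with hlt | heq
  · rw [Nat.mod_eq_of_lt hlt] at hval
    rw [Fin.lt_def, Fin.le_def, hval, Nat.lt_succ_iff]
  · rw [heq, Nat.mod_self] at hval
    exact absurd (Fin.ext hval) ht

theorem update_snapshot (hactive : c.activeStart ≤ c.transcript.length)
    (hnext : c.nextStart ≤ c.transcript.length) (x : X) :
    (A.poolAlgorithm m η mech enc dec).update (A.snapshot m η enc c) x =
      PMF.pure (A.snapshot m η enc (c.push (x, none))) := by
  rw [← Transcript.length_updates] at hactive hnext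
  simp only [poolAlgorithm, snapshot, Config.push, Transcript.updates_append,
    Transcript.queries_append_none, List.take_append_of_le_length hactive,
    List.take_append_of_le_length hnext, List.drop_append_of_le_length hactive,
    List.drop_append_of_le_length hnext, run_queried_append_singleton, List.length_append,
    List.length_singleton, finOfNat_add_one]

theorem IsLinearState.respond_add_eq_output (hA : A.IsLinearState m) (r : A.SR) (i : ℕ)
    {x : List X} (hx : x.length ≤ m) :
    A.respond r (A.vec (A.run r (queried (x.take i))).1 +
      A.vec (A.run r (queried (x.drop i))).1) = A.output r x := by
  have hlen : (queried (x.take i)).length + (queried (x.drop i)).length ≤ m := by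
    rwa [← List.length_append, ← queried_append, List.take_append_drop, queried, List.length_map]
  have hadd := hA r _ _ hlen
  rw [← queried_append, List.take_append_drop] at hadd
  exact congrArg _ hadd.symm

theorem IsLinearState.answer_snapshot (hA : A.IsLinearState m) (hm : c.transcript.length ≤ m) :
    (A.poolAlgorithm m η mech enc dec).answer (A.snapshot m η enc c) =
      (mech fun j => A.output (c.active j) c.transcript.updates).map
        fun z => (z, A.snapshot m η enc c) := by
  rw [← Transcript.length_updates] at hm
  simp only [poolAlgorithm, snapshot, hA.respond_add_eq_output _ _ hm]

theorem map_snapshot_settle_of_not_dvd {x : X} {z : ℝ} (hη : ¬η ∣ c.transcript.queries + 1) :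
    (settle A.coins (η * (k * b)) (c.push (x, some z))).map (A.snapshot m η enc) =
      PMF.pure (A.snapshot m η enc (c.push (x, none))) := by
  have hQ : ¬(c.push (x, some z)).transcript.queries % (η * (k * b)) = 0 := by
    rw [Config.push, Transcript.queries_append_some, ← Nat.dvd_iff_mod_eq_zero]
    exact fun hdvd => hη ((dvd_mul_right _ _).trans hdvd)
  rw [settle, if_neg hQ, PMF.pure_map]
  simp only [snapshot, Config.push, Transcript.updates_append, Transcript.queries_append_some,
    Transcript.queries_append_none, List.length_append, List.length_singleton,
    Nat.succ_div, if_neg hη, add_zero]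

theorem update_advice_snapshot (hm : c.nextStart ≤ m) :
    Function.update (A.snapshot m η enc c).advice (A.snapshot m η enc c).adviceCount
      ((A.poolAlgorithm m η mech enc dec).predicate (A.snapshot m η enc c) c.transcript.updates) =
    fun n => decide (n ≤ (A.snapshot m η enc c).adviceCount) &&
      A.adviceBit enc c.next (c.transcript.updates.take c.nextStart) n := by
  have hstart : (Fin.ofNat (m + 1) c.nextStart : ℕ) = c.nextStart :=
    Nat.mod_eq_of_lt (Nat.lt_succ_of_le hm)
  funext n
  rcases eq_or_ne n (A.snapshot m η enc c).adviceCount with rfl | hn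
  · simp only [poolAlgorithm, snapshot, hstart, Function.update_self, le_refl, decide_true,
      Bool.true_and]
  · simp only [Function.update_of_ne hn, hn.le_iff_lt]
    rfl

theorem snapshot_rotate (hdec : Function.LeftInverse dec enc)
    (hcount : (A.snapshot m η enc c).adviceCount = 0) (ρ : Fin k → A.SR) :
    A.snapshot m η enc (c.rotate ρ) =
      { active := c.next
        activePrefix := fun j => dec fun i => A.adviceBit enc c.next
          (c.transcript.updates.take c.nextStart) (finProdFinEquiv (j, i))
        activeSuffix := (A.snapshot m η enc c).nextSuffix
        next := ρ
        nextSuffix := fun j => (A.initV (ρ j), A.initC (ρ j))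
        advice := fun _ => false
        nextStart := (A.snapshot m η enc c).length
        length := (A.snapshot m η enc c).length
        adviceCount := 0 } := by
  have hcount' : Fin.ofNat (k * b) (c.transcript.queries / η) = 0 := hcount
  simp only [snapshot, Config.rotate, adviceBit, Equiv.symm_apply_apply, hdec _, hcount',
    Fin.not_lt_zero, decide_false, Bool.false_and, ← Transcript.length_updates, List.drop_length]
  rfl

theorem receive_snapshot (hdec : Function.LeftInverse dec enc) {x : X} {z : ℝ}
    (hdvd : η ∣ c.transcript.queries + 1) (hm : c.nextStart ≤ m) :
    (A.poolAlgorithm m η mech enc dec).receive (A.snapshot m η enc (c.push (x, none)))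
      ((A.poolAlgorithm m η mech enc dec).predicate (A.snapshot m η enc (c.push (x, none)))
        (c.transcript.updates ++ [x])) =
    (settle A.coins (η * (k * b)) (c.push (x, some z))).map (A.snapshot m η enc) := by
  set σ := A.snapshot m η enc (c.push (x, none)) with hσ
  set σ' := A.snapshot m η enc (c.push (x, some z)) with hσ'
  have hcount : σ'.adviceCount = σ.adviceCount + 1 := by
    simp only [hσ, hσ', snapshot, Config.push, Transcript.queries_append_some,
      Transcript.queries_append_none, Nat.succ_div, if_pos hdvd, finOfNat_add_one]
  have hfull : σ.adviceCount + 1 = 0 ↔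
      (c.push (x, some z)).transcript.queries % (η * (k * b)) = 0 := by
    rw [← hcount, hσ', snapshot, finOfNat_eq_zero_iff, ← Nat.dvd_iff_mod_eq_zero,
      ← Nat.dvd_iff_mod_eq_zero, Nat.dvd_div_iff_mul_dvd]
    rwa [Config.push, Transcript.queries_append_some]
  have hadvice : Function.update σ.advice σ.adviceCount
      ((A.poolAlgorithm m η mech enc dec).predicate σ (c.transcript.updates ++ [x])) =
      fun n => decide (n ≤ σ.adviceCount) &&
        A.adviceBit enc c.next ((c.transcript.updates ++ [x]).take c.nextStart) n := by
    rw [← Transcript.updates_append c.transcript (x, none)]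
    exact update_advice_snapshot (c := c.push (x, none)) hm
  by_cases hzero : σ.adviceCount + 1 = 0
  · rw [settle, if_pos (hfull.1 hzero), PMF.map_comp]
    refine (if_pos hzero).trans (congrArg (PMF.map · _) (funext fun ρ => ?_))
    rw [Function.comp_apply, snapshot_rotate hdec (hcount.trans hzero)]
    simp only [hadvice, fin_le_of_add_one_eq_zero hzero, decide_true, Bool.true_and]
    simp only [hσ, snapshot, Config.push, Transcript.updates_append, List.length_append,
      List.length_singleton]
  · rw [settle, if_neg (hfull.not.1 hzero), PMF.pure_map]
    refine (if_neg hzero).trans (congrArg PMF.pure ?_)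
    simp only [hadvice, ← fin_lt_add_one_iff hzero]
    rw [← hcount]
    simp only [hσ, hσ', snapshot, Config.push, Transcript.updates_append, List.length_append,
      List.length_singleton]
    rfl

theorem IsLinearState.round_snapshot (hA : A.IsLinearState m)
    (hdec : Function.LeftInverse dec enc) (B : Adversary X) (hc : c.IsTimely)
    (hm : c.transcript.length < m) :
    (A.poolAlgorithm m η mech enc dec).round η B (A.snapshot m η enc c, c.transcript) =
      ((B c.transcript).bind
        (poolStep A.coins (η * (k * b)) (poolAnswer mech A.output) c)).map
          fun c' => (A.snapshot m η enc c', c'.transcript) := by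
  refine ASAAlgorithm.round_eq_map (A := A.poolAlgorithm m η mech enc dec)
    (S := A.snapshot m η enc) (update_snapshot hc.1 hc.2) (fun x => ?_)
    (fun x z hdvd => (map_snapshot_settle_of_not_dvd hdvd).symm)
    fun x z hdvd => receive_snapshot hdec hdvd (hc.2.trans hm.le)
  have hlen : (c.push (x, none)).transcript.length ≤ m := by
    rwa [Config.push, List.length_append]
  rw [hA.answer_snapshot hlen, Config.push, Transcript.updates_append]
  rfl

theorem IsLinearState.play_poolAlgorithm (hA : A.IsLinearState m)
    (hdec : Function.LeftInverse dec enc) (B : Adversary X) {n : ℕ} (hn : n ≤ m) :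
    (A.poolAlgorithm m η mech enc dec).play η B n =
      (poolPlay A.coins (η * (k * b)) B (poolAnswer mech A.output) n).map
        fun c => (A.snapshot m η enc c, c.transcript) := by
  induction n with
  | zero =>
    refine (PMF.map_comp _ _ _).trans (map_congr_support fun c hc => ?_)
    have hlen : c.transcript.length = 0 := length_of_mem_support_poolPlay
      (Q := η * (k * b)) (B := B) (ans := poolAnswer mech A.output) hc
    rw [List.eq_nil_of_length_eq_zero hlen]
    rfl
  | succ n ih =>
    refine (congrArg (PMF.bind · _) (ih (by omega))).trans ((PMF.bind_map _ _ _).trans ?_)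
    rw [poolPlay, PMF.map_bind]
    refine bind_congr_support fun c hc => ?_
    refine hA.round_snapshot hdec B (isTimely_of_mem_support_poolPlay hc) ?_
    rwa [length_of_mem_support_poolPlay hc]

theorem IsLinearState.isRobust_poolAlgorithm (hA : A.IsLinearState m)
    (hdec : Function.LeftInverse dec enc) {g : List X → ℝ} {T : ℕ} {α β : ℝ} (hβ : 0 ≤ β)
    (hplay : ∀ B : Adversary X,
      (poolPlay A.coins (η * (k * b)) B (poolAnswer mech A.output) m).toOuterMeasure
        {c | ¬c.transcript.AllAccurate g α} ≤ ENNReal.ofReal β) :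
    (A.poolAlgorithm m η mech enc dec).IsRobust g m T η α β := by
  intro B _
  rw [hA.play_poolAlgorithm hdec B le_rfl]
  refine ((toOuterMeasure_le_ofReal_iff _ _ hβ).1 (hplay B)).trans_eq ?_
  refine Eq.trans ?_ (PMF.toOuterMeasure_map_apply _ _ _).symm
  congr 1
  ext c
  exact not_not

end SegmentedAlgorithm

end Simulation

section Deterministic

/-- The algorithm with the state transitions `upd` and the responses `ans`, which uses neither
randomness nor advice. -/
noncomputable def deterministicAlgorithm {X : Type*} {S : Type} [Finite S] (s₀ : S)
    (upd : S → X → S) (ans : S → ℝ) : ASAAlgorithm X where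
  State := S
  fintypeState := Fintype.ofFinite S
  init := PMF.pure s₀
  update σ x := PMF.pure (upd σ x)
  answer σ := PMF.pure (ans σ, σ)
  predicate _ _ := false
  receive σ _ := PMF.pure σ

variable {X : Type*} {S : Type} [Finite S] {s₀ : S} {upd : S → X → S} {ans : S → ℝ}
  {g : List X → ℝ} {m T η : ℕ} {α β : ℝ}

theorem space_deterministicAlgorithm :
    (deterministicAlgorithm s₀ upd ans).space = Nat.clog 2 (Nat.card S) := by
  rw [ASAAlgorithm.space, ← Nat.card_eq_fintype_card]
  rfl

theorem eq_of_mem_support_round_deterministicAlgorithm {B : Adversary X}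
    {c c' : (deterministicAlgorithm s₀ upd ans).State × Transcript X}
    (hc' : c' ∈ ((deterministicAlgorithm s₀ upd ans).round η B c).support) :
    ∃ p : X × Option ℝ, (∀ z, p.2 = some z → z = ans (upd c.1 p.1)) ∧
      c' = (upd c.1 p.1, c.2 ++ [p]) := by
  obtain ⟨⟨x, q⟩, -, hc'⟩ := (PMF.mem_support_bind_iff _ _ _).1 hc'
  cases q
  · refine ⟨(x, none), nofun, ?_⟩
    refine (PMF.mem_support_pure_iff _ _).1 ?_
    simpa only [deterministicAlgorithm, PMF.pure_bind, Bool.false_eq_true, if_false] using hc'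
  · refine ⟨(x, some (ans (upd c.1 x))), fun z hz => (Option.some_inj.1 hz).symm, ?_⟩
    refine (PMF.mem_support_pure_iff _ _).1 ?_
    simpa only [deterministicAlgorithm, PMF.pure_bind, if_true, PMF.pure_map, ite_self] using hc'

theorem mem_support_play_deterministicAlgorithm
    (hans : ∀ x : List X, x ≠ [] → x.length ≤ m → Accurate α (g x) (ans (x.foldl upd s₀)))
    {B : Adversary X} {n : ℕ} (hn : n ≤ m)
    {c : (deterministicAlgorithm s₀ upd ans).State × Transcript X}
    (hc : c ∈ ((deterministicAlgorithm s₀ upd ans).play η B n).support) :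
    c.1 = c.2.updates.foldl upd s₀ ∧ c.2.length = n ∧ c.2.AllAccurate g α := by
  induction n generalizing c with
  | zero =>
    obtain ⟨σ, hσ, rfl⟩ := (PMF.mem_support_map_iff _ _ _).1 hc
    exact ⟨(PMF.mem_support_pure_iff _ _).1 hσ, rfl, fun i hi => absurd hi i.not_lt_zero⟩
  | succ n ih =>
    obtain ⟨c₀, hc₀, hc⟩ := (PMF.mem_support_bind_iff _ _ _).1 hc
    obtain ⟨hstate, hlen, hacc⟩ := ih (by omega) hc₀
    obtain ⟨p, hp, rfl⟩ := eq_of_mem_support_round_deterministicAlgorithm hc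
    have hfold : (c₀.2.updates ++ [p.1]).foldl upd s₀ = upd c₀.1 p.1 := by
      rw [List.foldl_append, ← hstate]
      rfl
    refine ⟨?_, ?_, hacc.append fun z hz => ?_⟩
    · rw [Transcript.updates_append, hfold]
    · rw [List.length_append, List.length_singleton, hlen]
    · rw [hp z hz, ← hfold]
      refine hans _ (List.append_ne_nil_of_right_ne_nil _ (List.cons_ne_nil _ _)) ?_
      rwa [List.length_append, List.length_singleton, Transcript.length_updates, hlen]

theorem isRobust_deterministicAlgorithm (hβ : 0 ≤ β)
    (hans : ∀ x : List X, x ≠ [] → x.length ≤ m → Accurate α (g x) (ans (x.foldl upd s₀))) :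
    (deterministicAlgorithm s₀ upd ans).IsRobust g m T η α β := by
  intro B _
  refine (ENNReal.ofReal_le_one.2 (sub_le_self 1 hβ)).trans_eq ?_
  exact ((PMF.toOuterMeasure_apply_eq_one_iff _ _).2 fun c hc =>
    (mem_support_play_deterministicAlgorithm hans le_rfl hc).2.2).symm

theorem exists_isRobust_space_eq_zero {z : ℝ} (hβ : 0 ≤ β)
    (hz : ∀ x : List X, x ≠ [] → x.length ≤ m → Accurate α (g x) z) :
    ∃ A : ASAAlgorithm X, A.space = 0 ∧ ∀ T, A.IsRobust g m T η α β :=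
  ⟨deterministicAlgorithm () (fun _ _ => ()) fun _ => z, by
    rw [space_deterministicAlgorithm, Nat.card_unique, Nat.clog_one_right],
    fun _ => isRobust_deterministicAlgorithm hβ hz⟩

/-- The streams of length at most `m` over the domain `Fin k`. -/
abbrev BoundedList (k m : ℕ) : Type := {x : List (Fin k) // x.length ≤ m}

instance (k m : ℕ) : Finite (BoundedList k m) := List.finite_length_le (Fin k) m

theorem card_boundedList_le (k m : ℕ) : Nat.card (BoundedList k m) ≤ (k + 1) ^ m := by
  let toFun (x : BoundedList k m) (i : Fin m) : Option (Fin k) := x.1[(i : ℕ)]?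
  have hinj : Function.Injective toFun := fun x y hxy =>
    Subtype.ext <| List.ext_getElem? fun i => by
      rcases lt_or_ge i m with hi | hi
      · exact congrFun hxy ⟨i, hi⟩
      · rw [List.getElem?_eq_none (x.2.trans hi), List.getElem?_eq_none (y.2.trans hi)]
  refine (Nat.card_le_card_of_injective toFun hinj).trans_eq ?_
  rw [Nat.card_eq_fintype_card, Fintype.card_fun, Fintype.card_option, Fintype.card_fin,
    Fintype.card_fin]

/-- The algorithm that stores the stream and applies `f` to it; `e` enumerates the domain. -/
noncomputable def storingAlgorithm {X : Type*} {k : ℕ} (e : X ≃ Fin k) (m : ℕ) (f : List X → ℝ) :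
    ASAAlgorithm X :=
  deterministicAlgorithm (S := BoundedList k m) ⟨[], Nat.zero_le m⟩
    (fun σ x => ⟨(σ.1 ++ [e x]).take m, List.length_take_le _ _⟩) fun σ => f (σ.1.map e.symm)

theorem coe_foldl_append_take {Y : Type*} (e : X → Y) {x : List X} (hx : x.length ≤ m) :
    (x.foldl (fun (σ : {y : List Y // y.length ≤ m}) a =>
      ⟨(σ.1 ++ [e a]).take m, List.length_take_le _ _⟩) ⟨[], Nat.zero_le m⟩).1 = x.map e := by
  induction x using List.reverseRecOn with
  | nil => rw [List.foldl_nil, List.map_nil]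
  | append_singleton x a ih =>
    rw [List.length_append] at hx
    rw [List.foldl_append, List.foldl_cons, List.foldl_nil, ih (by omega), List.map_append,
      List.map_singleton]
    refine List.take_of_length_le ?_
    rwa [List.length_append, List.length_map]

theorem isRobust_storingAlgorithm {k : ℕ} (e : X ≃ Fin k) {f : List X → ℝ} (hβ : 0 ≤ β)
    (hf : ∀ x : List X, x ≠ [] → x.length ≤ m → Accurate α (g x) (f x)) :
    (storingAlgorithm e m f).IsRobust g m T η α β := by
  refine isRobust_deterministicAlgorithm hβ fun x hx hxm => ?_
  rw [coe_foldl_append_take e hxm, List.map_map, e.symm_comp_self, List.map_id]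
  exact hf x hx hxm

theorem space_storingAlgorithm_le {k : ℕ} (e : X ≃ Fin k) (m : ℕ) (f : List X → ℝ) :
    (storingAlgorithm e m f).space ≤ Nat.clog 2 ((k + 1) ^ m) :=
  space_deterministicAlgorithm.trans_le (Nat.clog_mono_right 2 (card_boundedList_le k m))

end Deterministic

namespace SegmentedAlgorithm

variable {X : Type*} {A : SegmentedAlgorithm X} {g : List X → ℝ} {m : ℕ} {α β : ℝ}

theorem IsOblivious.toOuterMeasure_not_accurate_le (hA : A.IsOblivious g m α β) (hβ : 0 ≤ β)
    {x : List X} (hx : x ≠ []) (hxm : x.length ≤ m) :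
    A.coins.toOuterMeasure {r | ¬Accurate α (g x) (A.output r x)} ≤ ENNReal.ofReal β := by
  set y := x ++ List.replicate (m - x.length) (x.head hx)
  have hylen : y.length = m := by
    rw [List.length_append, List.length_replicate]
    omega
  have htake : y.take x.length = x := List.take_left
  refine (toOuterMeasure_le_ofReal_iff _ _ hβ).2 ((hA y hylen).trans ?_)
  refine MeasureTheory.measure_mono fun r hr => not_not.2 ?_
  simpa only [htake] using hr x.length (List.length_pos_iff.2 hx) hxm

theorem IsOblivious.exists_accurate_output (hA : A.IsOblivious g m α β) (hβ : 0 ≤ β) (hβ' : β < 1)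
    {x : List X} (hx : x ≠ []) (hxm : x.length ≤ m) :
    ∃ r, Accurate α (g x) (A.output r x) := by
  by_contra! hbad
  refine (hA.toOuterMeasure_not_accurate_le hβ hx hxm).not_gt ?_
  refine (ENNReal.ofReal_lt_one.2 hβ').trans_eq ?_
  exact ((PMF.toOuterMeasure_apply_eq_one_iff _ _).2 fun r _ => hbad r).symm

theorem card_mul_card_mul_card_le {s : ℕ} (h : A.space ≤ s) :
    Fintype.card A.SR * (Fintype.card A.SV * Fintype.card A.SC) ≤ 2 ^ s := by
  rw [← Fintype.card_prod, ← Fintype.card_prod]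
  exact (Nat.clog_le_iff_le_pow one_lt_two).1 h

theorem exists_output_eq_const (hA : A.space = 0) : ∃ z, ∀ r x, A.output r x = z := by
  have hcard : Fintype.card (A.SR × A.SV × A.SC) ≤ 2 ^ 0 :=
    (Nat.clog_le_iff_le_pow one_lt_two).1 hA.le
  have := Fintype.card_le_one_iff_subsingleton.1 hcard
  obtain ⟨r₀, -⟩ := A.coins.support_nonempty
  refine ⟨A.respond r₀ (A.vec (A.initV r₀)), fun r x => ?_⟩
  obtain ⟨hr, hv⟩ := Prod.ext_iff.1 <| Subsingleton.elim
    (r, A.run r (x.map fun a => (a, true))) (r₀, A.initV r₀, A.initC r₀)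
  obtain rfl : r = r₀ := hr
  exact congrArg (fun σ => A.respond r (A.vec σ.1)) hv

end SegmentedAlgorithm

section Space

theorem natCast_clog_two_le {n : ℕ} (hn : 1 ≤ n) : (Nat.clog 2 n : ℝ) ≤ 2 * Real.log n + 1 := by
  have hlog : 0 ≤ Real.log n := Real.log_natCast_nonneg n
  have hlog2 := Real.log_two_gt_d9
  have hlogb : Real.logb 2 n ≤ 2 * Real.log n := by
    rw [Real.logb, div_le_iff₀ (by linarith)]
    nlinarith
  have hceil := Nat.ceil_lt_add_one (Real.logb_nonneg one_lt_two (Nat.one_le_cast.2 hn))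
  have hclog := Real.natCeil_logb_natCast 2 n
  rw [Nat.cast_ofNat] at hclog
  rw [hclog] at hceil
  linarith

theorem natCast_clog_two_add_one_pow_le {c k m : ℕ} (hm : 2 ≤ m) (hk : k ≤ m ^ c) :
    (Nat.clog 2 ((k + 1) ^ m) : ℝ) ≤ (2 * c + 3) * (m * Real.log m) := by
  have hm' : (2 : ℝ) ≤ m := by exact_mod_cast hm
  have hlog := Real.log_le_log two_pos hm'
  have hlog2 := Real.log_two_gt_d9
  have hk' : k + 1 ≤ m ^ (c + 1) :=
    calc k + 1 ≤ m ^ c + m ^ c := Nat.add_le_add hk (Nat.one_le_pow c m (by omega))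
      _ = m ^ c * 2 := (mul_two _).symm
      _ ≤ m ^ (c + 1) := Nat.mul_le_mul_left _ hm
  have hpow : (k + 1) ^ m ≤ m ^ ((c + 1) * m) := by
    rw [pow_mul]
    exact Nat.pow_le_pow_left hk' m
  calc (Nat.clog 2 ((k + 1) ^ m) : ℝ) ≤ Nat.clog 2 (m ^ ((c + 1) * m)) := by
        exact_mod_cast Nat.clog_mono_right 2 hpow
    _ ≤ 2 * Real.log ((m ^ ((c + 1) * m) : ℕ) : ℝ) + 1 :=
        natCast_clog_two_le (Nat.one_le_pow _ m (by omega))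
    _ = (2 * c + 2) * (m * Real.log m) + 1 := by
        rw [Nat.cast_pow, Real.log_pow]
        push_cast
        ring
    _ ≤ (2 * c + 3) * (m * Real.log m) := by nlinarith

namespace SegmentedAlgorithm

variable {X : Type*} {A : SegmentedAlgorithm X} {s k m η : ℕ}

theorem card_SR_mul_card_SV_le (hs : A.space ≤ s) :
    Fintype.card A.SR * Fintype.card A.SV ≤ 2 ^ s := by
  obtain ⟨r, -⟩ := A.coins.support_nonempty
  have : 0 < Fintype.card A.SC := Fintype.card_pos_iff.2 ⟨A.initC r⟩
  refine le_trans ?_ (card_mul_card_mul_card_le hs)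
  rw [← mul_assoc]
  exact Nat.le_mul_of_pos_right _ this

theorem card_SV_le (hs : A.space ≤ s) : Fintype.card A.SV ≤ 2 ^ s := by
  obtain ⟨r, -⟩ := A.coins.support_nonempty
  exact (Nat.le_mul_of_pos_left _ (Fintype.card_pos_iff.2 ⟨r⟩)).trans (card_SR_mul_card_SV_le hs)

theorem card_poolMemory_le (hs : A.space ≤ s) (hm : m + 1 ≤ 2 ^ (k * s)) :
    Fintype.card (A.PoolMemory k s m) ≤ 2 ^ (7 * (k * s)) := by
  have hmem := card_mul_card_mul_card_le hs
  have hks : k * s ≤ 2 ^ (k * s) := Nat.lt_two_pow_self.le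
  rw [Fintype.card_congr (PoolMemory.equivProd A k s m)]
  simp only [Fintype.card_prod, Fintype.card_fun, Fintype.card_fin, Fintype.card_bool]
  set r := Fintype.card A.SR
  set v := Fintype.card A.SV
  set w := Fintype.card A.SC
  calc _ = (v * (r * (v * w))) ^ k * (r * (v * w)) ^ k * 2 ^ (k * s) * (m + 1) * (m + 1) *
        (k * s) := by ring
    _ ≤ (2 ^ s * 2 ^ s) ^ k * (2 ^ s) ^ k * 2 ^ (k * s) * 2 ^ (k * s) * 2 ^ (k * s) *
        2 ^ (k * s) := by
        have hv : v ≤ 2 ^ s := card_SV_le hs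
        gcongr
    _ = 2 ^ (7 * (k * s)) := by ring

theorem space_poolAlgorithm_le [NeZero (k * s)] {mech : (Fin k → ℝ) → PMF ℝ}
    {enc : A.SV → Fin s → Bool} {dec : (Fin s → Bool) → A.SV} (hs : A.space ≤ s)
    (hm : m + 1 ≤ 2 ^ (k * s)) :
    (A.poolAlgorithm m η mech enc dec).space ≤ 7 * (k * s) :=
  (Nat.clog_le_iff_le_pow one_lt_two).2 (card_poolMemory_le hs hm)

theorem exists_leftInverse_encoding (hs : A.space ≤ s) :
    ∃ (enc : A.SV → Fin s → Bool) (dec : (Fin s → Bool) → A.SV), Function.LeftInverse dec enc := by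
  obtain ⟨r, -⟩ := A.coins.support_nonempty
  have : Nonempty A.SV := ⟨A.initV r⟩
  have hcard : Fintype.card A.SV ≤ Fintype.card (Fin s → Bool) := by
    simpa only [Fintype.card_fun, Fintype.card_bool, Fintype.card_fin] using card_SV_le hs
  obtain ⟨enc⟩ := Function.Embedding.nonempty_of_card_le hcard
  exact ⟨enc, Function.invFun enc, Function.leftInverse_invFun enc.injective⟩

theorem exists_finset_output_mem (hs : A.space ≤ s) :
    ∃ V : Finset ℝ, #V ≤ 2 ^ s ∧ ∀ r x, A.output r x ∈ V := by
  classical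
  refine ⟨Finset.univ.image fun p : A.SR × A.SV => A.respond p.1 (A.vec p.2), ?_, fun r x =>
    Finset.mem_image.2 ⟨(r, (A.run r (queried x)).1), Finset.mem_univ _, rfl⟩⟩
  refine Finset.card_image_le.trans ?_
  rw [Finset.card_univ, Fintype.card_prod]
  exact card_SR_mul_card_SV_le hs

end SegmentedAlgorithm

end Space

section Parameters

theorem choose_mul_pow_le {κ l : ℕ} (hl : l ≤ κ) :
    ((100 * κ).choose l : ℝ) * (7 / 20) ^ l ≤ (5 / 6) ^ l * ((43 * κ).choose l : ℝ) := by
  have hupper : (l.factorial : ℝ) * (100 * κ).choose l ≤ (100 * κ : ℝ) ^ l := by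
    have := Nat.descFactorial_le_pow (100 * κ) l
    rw [Nat.descFactorial_eq_factorial_mul_choose] at this
    exact_mod_cast this
  have hlower : (42 * κ : ℝ) ^ l ≤ l.factorial * (43 * κ).choose l := by
    have := (Nat.pow_le_pow_left (by omega : 42 * κ ≤ 43 * κ + 1 - l) l).trans
      (Nat.pow_sub_le_descFactorial (43 * κ) l)
    rw [Nat.descFactorial_eq_factorial_mul_choose] at this
    exact_mod_cast this
  refine le_of_mul_le_mul_left ?_ (Nat.cast_pos.2 l.factorial_pos : (0 : ℝ) < l.factorial)
  calc (l.factorial : ℝ) * ((100 * κ).choose l * (7 / 20) ^ l)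
      = (l.factorial * (100 * κ).choose l) * (7 / 20) ^ l := by ring
    _ ≤ (100 * κ : ℝ) ^ l * (7 / 20) ^ l := by gcongr
    _ = (5 / 6) ^ l * (42 * κ : ℝ) ^ l := by
        rw [← mul_pow, ← mul_pow]
        ring
    _ ≤ (5 / 6) ^ l * (l.factorial * (43 * κ).choose l) := by gcongr
    _ = _ := by ring

theorem exp_add_sq_sub_one_mem_Icc {u : ℝ} (hu₀ : 0 ≤ u) (hu : u ≤ 1 / 4) :
    Real.exp u + u ^ 2 - 1 ∈ Set.Icc 0 (3 / 2 * u) := by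
  have habs := Real.abs_exp_sub_one_sub_id_le (x := u) (by rw [abs_of_nonneg hu₀]; linarith)
  exact ⟨by nlinarith [Real.add_one_le_exp u], by nlinarith [(abs_le.1 habs).2]⟩

theorem one_add_exp_add_sq_sub_one_sq_le {u : ℝ} (hu₀ : 0 ≤ u) (hu : u ≤ 1 / 4) :
    1 + (Real.exp u + u ^ 2 - 1) ^ 2 + u ^ 2 ≤ Real.exp (4 * u ^ 2) := by
  obtain ⟨hlower, hupper⟩ := exp_add_sq_sub_one_mem_Icc hu₀ hu
  nlinarith [pow_le_pow_left₀ hlower hupper 2, Real.add_one_le_exp (4 * u ^ 2)]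

theorem exp_one_fifth_le : Real.exp (1 / 5) ≤ 49 / 40 := by
  refine le_of_pow_le_pow_left₀ (n := 5) (by norm_num) (by norm_num) ?_
  rw [← Real.exp_nat_mul]
  norm_num
  linarith [Real.exp_one_lt_d9]

theorem exists_isStable_isInterior_exp {ι : Type*} [Fintype ι] {κ l s : ℕ} {u : ℝ} {V : Finset ℝ}
    (hcard : Fintype.card ι = 100 * κ) (hV : #V ≤ 2 ^ s) (hl : 1 ≤ l) (hlκ : 2 * l ≤ κ)
    (hu₀ : 0 < u) (hu : u ≤ 1 / 4) :
    ∃ mech : (ι → ℝ) → PMF ℝ, IsStable l (ENNReal.ofReal (Real.exp (4 * u ^ 2))) mech ∧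
      ∀ y, (∀ j, y j ∈ V) → (mech y).toOuterMeasure {z | ¬ IsInterior (43 * κ) y z} ≤
        ENNReal.ofReal
          (200 * (s + 1) * Real.exp u / u ^ 2 / Real.exp (u / l) ^ (3 * κ)) := by
  obtain ⟨hδ₀, hδ⟩ := exp_add_sq_sub_one_mem_Icc hu₀.le hu
  have hxl : Real.exp (u / l) ^ l = Real.exp u := by
    rw [← Real.exp_nat_mul, mul_div_cancel₀ _ (by positivity)]
  obtain ⟨x, hx⟩ : ∃ x : ℝ≥0, (x : ℝ) = Real.exp (u / l) := ⟨⟨_, (Real.exp_pos _).le⟩, rfl⟩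
  obtain ⟨W, hW⟩ : ∃ W : ℝ≥0, (W : ℝ) = 200 * (s + 1) * Real.exp u / u ^ 2 :=
    ⟨⟨_, by positivity⟩, rfl⟩
  obtain ⟨θ, hθ⟩ : ∃ θ : ℝ≥0, (θ : ℝ) = u ^ 2 := ⟨⟨_, sq_nonneg u⟩, rfl⟩
  lift Real.exp u + u ^ 2 - 1 to ℝ≥0 using hδ₀ with δ hδu
  obtain ⟨mech, hstable, hinterior⟩ := exists_isStable_isInterior (x := x) (W := W) (δ := δ)
    (θ := θ) hcard (hV.trans_lt (Nat.pow_lt_pow_right one_lt_two s.lt_succ_self)) (by omega) hlκ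
    (by rw [← NNReal.coe_le_coe, hx, NNReal.coe_one]; exact Real.one_le_exp (by positivity))
    (by rw [← NNReal.coe_pos, hW]; positivity)
    (by rw [← NNReal.coe_le_coe]; push_cast; rw [hx, hW, hθ, hxl]; field_simp; rfl)
    (by rw [← NNReal.coe_le_one]; linarith)
    (by rw [← NNReal.coe_le_coe]; push_cast; rw [hx, hθ, hxl]; linarith)
  refine ⟨mech, hstable.mono ?_, fun y hy => (hinterior y hy).trans_eq ?_⟩
  · rw [← ENNReal.ofReal_coe_nnreal]
    push_cast
    rw [hδu, hθ]
    exact ENNReal.ofReal_le_ofReal (one_add_exp_add_sq_sub_one_sq_le hu₀.le hu)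
  · rw [← ENNReal.ofReal_coe_nnreal, NNReal.coe_div, NNReal.coe_pow, hW, hx]

/-- The size of a pool of samples, divided by `100`. It is chosen such that the weight
`exp (u / l) ^ (3 * poolScale l η s)`, where `u = responseCost l η s`, of a good response is
`exp (60 * l)`. -/
def poolScale (l η s : ℕ) : ℕ := 800000 * (l ^ 3 * η * s)

/-- The change of the log-weight of a response when `l` samples are ignored. It is chosen such that
the factors `exp (4 * u ^ 2)` for the queries of an epoch, of which there are
`η * (100 * poolScale l η s * s)`, multiply to `exp (l / 5)`. -/
noncomputable def responseCost (l η s : ℕ) : ℝ := 1 / (40000 * l * η * s)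

variable {l η s m : ℕ} {β : ℝ}

theorem exp_responseCost_div_pow_poolScale (hl : 1 ≤ l) (hη : 1 ≤ η) (hs : 1 ≤ s) :
    Real.exp (responseCost l η s / l) ^ (3 * poolScale l η s) = Real.exp (60 * l) := by
  rw [← Real.exp_nat_mul, poolScale, responseCost]
  congr 1
  push_cast
  field_simp
  norm_num

theorem exp_responseCost_sq_pow_epoch (hl : 1 ≤ l) (hη : 1 ≤ η) (hs : 1 ≤ s) :
    Real.exp (4 * responseCost l η s ^ 2) ^ (η * (100 * poolScale l η s * s)) =
      Real.exp (1 / 5) ^ l := by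
  rw [← Real.exp_nat_mul, ← Real.exp_nat_mul, poolScale, responseCost]
  congr 1
  push_cast
  field_simp
  norm_num

theorem responseCost_pos (hl : 1 ≤ l) (hη : 1 ≤ η) (hs : 1 ≤ s) : 0 < responseCost l η s := by
  unfold responseCost
  positivity

theorem responseCost_le (hl : 1 ≤ l) (hη : 1 ≤ η) (hs : 1 ≤ s) : responseCost l η s ≤ 1 / 4 := by
  have hden : (1 : ℝ) ≤ (l * η * s : ℕ) :=
    Nat.one_le_cast.2 (Nat.mul_pos (Nat.mul_pos hl hη) hs)
  push_cast at hden
  exact one_div_le_one_div_of_le (by norm_num) (by linarith)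

theorem exp_responseCost_sq_pow_epoch_mul_le (hl : 1 ≤ l) (hη : 1 ≤ η) (hs : 1 ≤ s) :
    ENNReal.ofReal (Real.exp (4 * responseCost l η s ^ 2)) ^ (η * (100 * poolScale l η s * s)) *
      ENNReal.ofReal (1 / 10) ^ l ≤ ENNReal.ofReal ((7 / 20) ^ l) ^ 2 := by
  rw [← ENNReal.ofReal_pow (Real.exp_pos _).le, ← ENNReal.ofReal_pow (by norm_num),
    ← ENNReal.ofReal_pow (by positivity), ← ENNReal.ofReal_mul (by positivity),
    exp_responseCost_sq_pow_epoch hl hη hs, ← mul_pow, ← pow_mul, mul_comm l 2, pow_mul]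
  refine ENNReal.ofReal_le_ofReal (pow_le_pow_left₀ (by positivity) ?_ l)
  linarith [exp_one_fifth_le]

theorem SegmentedAlgorithm.IsLinearState.exists_isRobust_of_failure_le {X : Type*}
    {A : SegmentedAlgorithm X} {g : List X → ℝ} {α : ℝ} (hA : A.IsLinearState m)
    (hobl : A.IsOblivious g m α (1 / 10)) (hspace : A.space ≤ s) (hs : 1 ≤ s) (hη : 1 ≤ η)
    (hl : 1 ≤ l) (hβ : 0 ≤ β) (hml : m + 1 ≤ 2 ^ l)
    (hfail : (m : ℝ) * (m * (5 / 6) ^ l + 200 * (s + 1) * Real.exp (responseCost l η s) /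
      responseCost l η s ^ 2 / Real.exp (60 * l)) ≤ β) :
    ∃ A' : ASAAlgorithm X, A'.space ≤ 560000000 * (l ^ 3 * η * s ^ 2) ∧
      ∀ T, A'.IsRobust g m T η α β := by
  have hlκ : 2 * l ≤ poolScale l η s := by
    have : l ≤ l ^ 3 * η * s :=
      (Nat.le_self_pow three_ne_zero l).trans <| (Nat.le_mul_of_pos_right _ hη).trans
        (Nat.le_mul_of_pos_right _ hs)
    unfold poolScale
    omega
  have hks : l ≤ 100 * poolScale l η s * s := le_trans (by omega) (Nat.le_mul_of_pos_right _ hs)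
  have : NeZero (100 * poolScale l η s * s) := ⟨by omega⟩
  obtain ⟨enc, dec, hdec⟩ := exists_leftInverse_encoding hspace
  obtain ⟨V, hV, hval⟩ := exists_finset_output_mem hspace
  obtain ⟨mech, hstable, hinterior⟩ := exists_isStable_isInterior_exp (Fintype.card_fin _) hV hl
    hlκ (responseCost_pos hl hη hs) (responseCost_le hl hη hs)
  rw [exp_responseCost_div_pow_poolScale hl hη hs] at hinterior
  refine ⟨A.poolAlgorithm m η mech enc dec, ?_, fun T =>
    hA.isRobust_poolAlgorithm hdec hβ fun B => ?_⟩
  · refine (space_poolAlgorithm_le hspace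
      (hml.trans (Nat.pow_le_pow_right two_pos hks))).trans_eq ?_
    rw [poolScale]
    ring
  · refine (toOuterMeasure_poolPlay_not_allAccurate_le (D := ENNReal.ofReal ((5 / 6) ^ l))
      (V := (V : Set ℝ)) (Nat.mul_pos hη (by omega))
      (ENNReal.one_le_ofReal.2 (Real.one_le_exp (by positivity))) hstable hval hinterior
      (fun x hx hxm => hobl.toOuterMeasure_not_accurate_le (by norm_num) hx hxm) (by omega)
      (exp_responseCost_sq_pow_epoch_mul_le hl hη hs) ?_ le_rfl).trans ?_
    · rw [Fintype.card_fin, ← ENNReal.ofReal_natCast, ← ENNReal.ofReal_natCast,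
        ← ENNReal.ofReal_mul (by positivity), ← ENNReal.ofReal_mul (by positivity)]
      exact ENNReal.ofReal_le_ofReal (choose_mul_pow_le (by omega))
    · rw [← ENNReal.ofReal_natCast, ← ENNReal.ofReal_mul (by positivity),
        ← ENNReal.ofReal_add (by positivity) (by positivity), ← ENNReal.ofReal_mul (by positivity)]
      exact ENNReal.ofReal_le_ofReal hfail

end Parameters

section FailureProbability

variable {m l η s : ℕ} {β : ℝ}

theorem pow_le_exp_of_mul_log_le {y t : ℝ} (hy : 0 < y) (n : ℕ) (h : n * Real.log y ≤ t) :
    y ^ n ≤ Real.exp t :=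
  (Real.log_le_iff_le_exp (pow_pos hy n)).1 (by rwa [Real.log_pow])

theorem pow_le_mul_div_pow (hβ : 0 < β) (hβ₁ : β ≤ 1) {n : ℕ} (hn : n ≠ 0) :
    (m : ℝ) ^ n ≤ β * (m / β) ^ n :=
  calc (m : ℝ) ^ n = β ^ n * (m / β) ^ n := by rw [← mul_pow, mul_div_cancel₀ _ hβ.ne']
    _ ≤ β * (m / β) ^ n := by gcongr; exact pow_le_of_le_one hβ.le hβ₁ hn

theorem mul_mul_five_sixths_pow_le (hm : 2 ≤ m) (hβ : 0 < β) (hβ₁ : β ≤ 1)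
    (hl : 30 * Real.log (m / β) ≤ l) : (m : ℝ) * (m * (5 / 6) ^ l) ≤ β / 2 := by
  have hm' : (2 : ℝ) ≤ m := by exact_mod_cast hm
  have hexp : ((5 : ℝ) / 6) ^ l ≤ (Real.exp (l / 6))⁻¹ :=
    calc ((5 : ℝ) / 6) ^ l ≤ Real.exp (-(1 / 6)) ^ l := by
          gcongr
          linarith [Real.add_one_le_exp (-(1 / 6) : ℝ)]
      _ = (Real.exp (l / 6))⁻¹ := by
          rw [← Real.exp_nat_mul, ← Real.exp_neg]
          ring_nf
  have hpow : (m / β) ^ 5 ≤ Real.exp (l / 6) :=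
    pow_le_exp_of_mul_log_le (by positivity) 5 (by push_cast; linarith)
  have hm5 : 2 * (m : ℝ) ^ 2 ≤ m ^ 5 :=
    calc 2 * (m : ℝ) ^ 2 ≤ (m : ℝ) ^ 3 * m ^ 2 := by
          gcongr
          nlinarith [pow_le_pow_left₀ two_pos.le hm' 3]
      _ = (m : ℝ) ^ 5 := by ring
  calc (m : ℝ) * (m * (5 / 6) ^ l) = m ^ 2 * (5 / 6) ^ l := by ring
    _ ≤ (m : ℝ) ^ 2 / Real.exp (l / 6) :=
        (mul_le_mul_of_nonneg_left hexp (by positivity)).trans_eq (div_eq_mul_inv _ _).symm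
    _ ≤ β / 2 := by
        rw [div_le_div_iff₀ (Real.exp_pos _) two_pos]
        linarith [pow_le_mul_div_pow hβ hβ₁ (m := m) (by norm_num : 5 ≠ 0),
          mul_le_mul_of_nonneg_left hpow hβ.le]

theorem exp_responseCost_div_sq_le (hl : 1 ≤ l) (hη : 1 ≤ η) (hs : 1 ≤ s) (hm : η * s ^ 2 ≤ m) :
    200 * (s + 1) * Real.exp (responseCost l η s) / responseCost l η s ^ 2 ≤
      2 ^ 41 * ((l : ℝ) ^ 2 * m ^ 2) := by
  have hs' : (1 : ℝ) ≤ s := by exact_mod_cast hs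
  have hm' : (η * s ^ 2 : ℝ) ≤ m := by exact_mod_cast hm
  have hexp : Real.exp (responseCost l η s) ≤ 3 :=
    (Real.exp_le_exp.2 ((responseCost_le hl hη hs).trans (by norm_num))).trans
      Real.exp_one_lt_three.le
  have hηs : (s : ℝ) * (η ^ 2 * s ^ 2) ≤ m ^ 2 :=
    calc (s : ℝ) * (η ^ 2 * s ^ 2) ≤ (s : ℝ) ^ 2 * (η ^ 2 * s ^ 2) := by
          gcongr
          exact le_self_pow₀ hs' two_ne_zero
      _ = (η * s ^ 2 : ℝ) ^ 2 := by ring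
      _ ≤ (m : ℝ) ^ 2 := by gcongr
  calc 200 * (s + 1) * Real.exp (responseCost l η s) / responseCost l η s ^ 2
      ≤ 200 * (s + s) * 3 / responseCost l η s ^ 2 := by gcongr
    _ = 1920000000000 * ((l : ℝ) ^ 2 * (s * (η ^ 2 * s ^ 2))) := by
        rw [responseCost]
        field_simp
        norm_num
    _ ≤ 2 ^ 41 * ((l : ℝ) ^ 2 * m ^ 2) := by
        gcongr
        norm_num

theorem mul_responseFailure_le (hβ : 0 < β) (hβ₁ : β ≤ 1) (hl₁ : 1 ≤ l)
    (hl : 30 * Real.log (m / β) ≤ l) (hη : 1 ≤ η) (hs : 1 ≤ s) (hm : η * s ^ 2 ≤ m) :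
    (m : ℝ) * (200 * (s + 1) * Real.exp (responseCost l η s) / responseCost l η s ^ 2 /
      Real.exp (60 * l)) ≤ β / 2 := by
  have hm₀ : 0 < m := (Nat.mul_pos hη (pow_pos hs 2)).trans_le hm
  have hl' : (1 : ℝ) ≤ l := by exact_mod_cast hl₁
  have hl2 : (l : ℝ) ^ 2 ≤ 2 * Real.exp l := by
    linarith [Real.quadratic_le_exp_of_nonneg l.cast_nonneg, (l.cast_nonneg : (0 : ℝ) ≤ l)]
  have hm3 : (m : ℝ) ^ 3 ≤ β * Real.exp l :=
    (pow_le_mul_div_pow hβ hβ₁ three_ne_zero).trans <| mul_le_mul_of_nonneg_left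
      (pow_le_exp_of_mul_log_le (by positivity) 3 (by push_cast; linarith)) hβ.le
  have hexp : (2 : ℝ) ^ 43 ≤ Real.exp (58 * l) :=
    pow_le_exp_of_mul_log_le two_pos 43 (by push_cast; linarith [Real.log_two_lt_d9])
  rw [mul_div_assoc', div_le_iff₀ (Real.exp_pos _)]
  calc (m : ℝ) * (200 * (s + 1) * Real.exp (responseCost l η s) / responseCost l η s ^ 2)
      ≤ m * (2 ^ 41 * (l ^ 2 * m ^ 2)) := by
        gcongr
        exact exp_responseCost_div_sq_le hl₁ hη hs hm
    _ = 2 ^ 41 * (l : ℝ) ^ 2 * (m : ℝ) ^ 3 := by ring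
    _ ≤ 2 ^ 41 * (2 * Real.exp l) * (β * Real.exp l) := by gcongr
    _ = β / 2 * (Real.exp l * Real.exp l * 2 ^ 43) := by ring
    _ ≤ β / 2 * (Real.exp l * Real.exp l * Real.exp (58 * l)) := by gcongr
    _ = β / 2 * Real.exp (60 * l) := by
        rw [← Real.exp_add, ← Real.exp_add]
        ring_nf

theorem succ_le_two_pow (hm : 2 ≤ m) (hl : 30 * Real.log m ≤ l) : m + 1 ≤ 2 ^ l := by
  have hpow : (m : ℝ) ^ 2 ≤ 2 ^ l := by
    refine (pow_le_exp_of_mul_log_le (t := l * Real.log 2) (by positivity) 2 ?_).trans_eq ?_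
    · push_cast
      nlinarith [Real.log_two_gt_d9, Real.log_natCast_nonneg m]
    · rw [Real.exp_nat_mul, Real.exp_log two_pos]
  have : m ^ 2 ≤ 2 ^ l := by exact_mod_cast hpow
  nlinarith

end FailureProbability

theorem accurate_zero_of_one_le {α : ℝ} (hα : 1 ≤ α) (y : ℝ) : Accurate α y 0 := by
  rw [Accurate, zero_sub, abs_neg]
  exact le_mul_of_one_le_left (abs_nonneg y) hα

theorem log_two_le_log_div {m : ℕ} {β : ℝ} (hm : 2 ≤ m) (hβ : 0 < β) (hβ₁ : β ≤ 1) :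
    Real.log 2 ≤ Real.log (m / β) := by
  refine Real.log_le_log two_pos ((le_div_iff₀ hβ).2 ?_)
  have hm' : (2 : ℝ) ≤ m := by exact_mod_cast hm
  linarith

theorem mul_log_le_of_le_mul_sq {m η s : ℕ} {β : ℝ} (hm : 2 ≤ m) (hms : m ≤ η * s ^ 2)
    (hβ : 0 < β) (hβ₁ : β ≤ 1) :
    m * Real.log m ≤ 4 * (η * (s : ℝ) ^ 2 * Real.log (m / β) ^ 3) := by
  have hlog : 1 / 2 ≤ Real.log (m / β) := by
    linarith [log_two_le_log_div hm hβ hβ₁, Real.log_two_gt_d9]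
  have hlogm : Real.log m ≤ Real.log (m / β) :=
    Real.log_le_log (by positivity) (le_div_self m.cast_nonneg hβ hβ₁)
  have hms' : (m : ℝ) ≤ η * s ^ 2 := by exact_mod_cast hms
  calc m * Real.log m ≤ η * (s : ℝ) ^ 2 * (Real.log (m / β) * 1) := by
        rw [mul_one]
        gcongr
    _ ≤ η * (s : ℝ) ^ 2 * (Real.log (m / β) * (4 * Real.log (m / β) ^ 2)) := by
        gcongr
        nlinarith
    _ = 4 * (η * (s : ℝ) ^ 2 * Real.log (m / β) ^ 3) := by ring

namespace SegmentedAlgorithm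

variable {X : Type*} {A : SegmentedAlgorithm X} {g : List X → ℝ} {m η s : ℕ} {α β δ : ℝ}

theorem IsOblivious.exists_const_accurate_of_space_eq_zero (hA : A.IsOblivious g m α δ)
    (hδ : 0 ≤ δ) (hδ₁ : δ < 1) (hspace : A.space = 0) :
    ∃ z, ∀ x : List X, x ≠ [] → x.length ≤ m → Accurate α (g x) z := by
  obtain ⟨z, hz⟩ := exists_output_eq_const hspace
  refine ⟨z, fun x hx hxm => ?_⟩
  obtain ⟨r, hr⟩ := hA.exists_accurate_output hδ hδ₁ hx hxm
  rwa [hz] at hr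

theorem IsOblivious.exists_const_accurate_of_subsingleton [Subsingleton X]
    (hA : A.IsOblivious g 1 α δ) (hδ : 0 ≤ δ) (hδ₁ : δ < 1) :
    ∃ z, ∀ x : List X, x ≠ [] → x.length ≤ 1 → Accurate α (g x) z := by
  rcases isEmpty_or_nonempty X with _ | ⟨⟨a⟩⟩
  · exact ⟨0, fun x hx => absurd (Subsingleton.elim x []) hx⟩
  obtain ⟨r, hr⟩ := hA.exists_accurate_output hδ hδ₁ (List.cons_ne_nil a []) le_rfl
  refine ⟨A.output r [a], fun x hx hx₁ => ?_⟩
  obtain ⟨b, rfl⟩ :=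
    List.length_eq_one_iff.1 (le_antisymm hx₁ (List.length_pos_iff.2 hx))
  rwa [Subsingleton.elim b a]

theorem IsOblivious.exists_isRobust_space_le [Fintype X] {c : ℕ} (hA : A.IsOblivious g m α δ)
    (hδ : 0 ≤ δ) (hδ₁ : δ < 1) (hm : 2 ≤ m) (hX : Fintype.card X ≤ m ^ c) (hms : m ≤ η * s ^ 2)
    (hβ : 0 < β) (hβ₁ : β ≤ 1) :
    ∃ A' : ASAAlgorithm X,
      (A'.space : ℝ) ≤ 4 * (2 * c + 3) * (η * (s : ℝ) ^ 2 * Real.log (m / β) ^ 3) ∧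
        ∀ T, A'.IsRobust g m T η α β := by
  have : Nonempty A.SR := ⟨A.coins.support_nonempty.some⟩
  choose! r hr using fun (x : List X) (hx : x ≠ []) (hxm : x.length ≤ m) =>
    hA.exists_accurate_output hδ hδ₁ hx hxm
  let A' := storingAlgorithm (Fintype.equivFin X) m fun x => A.output (r x) x
  refine ⟨A', ?_, fun _ => isRobust_storingAlgorithm _ hβ.le hr⟩
  calc (A'.space : ℝ) ≤ Nat.clog 2 ((Fintype.card X + 1) ^ m) :=
        Nat.cast_le.2 (space_storingAlgorithm_le _ _ _)
    _ ≤ (2 * c + 3) * (m * Real.log m) := natCast_clog_two_add_one_pow_le hm hX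
    _ ≤ (2 * c + 3) * (4 * (η * (s : ℝ) ^ 2 * Real.log (m / β) ^ 3)) :=
        mul_le_mul_of_nonneg_left (mul_log_le_of_le_mul_sq hm hms hβ hβ₁) (by positivity)
    _ = 4 * (2 * c + 3) * (η * (s : ℝ) ^ 2 * Real.log (m / β) ^ 3) := by ring

theorem IsLinearState.exists_isRobust_space_le (hA : A.IsLinearState m)
    (hobl : A.IsOblivious g m α (1 / 10)) (hspace : A.space ≤ s) (hs : 1 ≤ s) (hη : 1 ≤ η)
    (hm : 2 ≤ m) (hms : η * s ^ 2 ≤ m) (hβ : 0 < β) (hβ₁ : β ≤ 1) :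
    ∃ A' : ASAAlgorithm X,
      (A'.space : ℝ) ≤ 560000000 * 32 ^ 3 * (η * (s : ℝ) ^ 2 * Real.log (m / β) ^ 3) ∧
        ∀ T, A'.IsRobust g m T η α β := by
  have hlog : 1 / 2 ≤ Real.log (m / β) := by
    linarith [log_two_le_log_div hm hβ hβ₁, Real.log_two_gt_d9]
  have hlogm : Real.log m ≤ Real.log (m / β) :=
    Real.log_le_log (by positivity) (le_div_self m.cast_nonneg hβ hβ₁)
  set l := ⌈30 * Real.log (m / β)⌉₊
  have hl : 30 * Real.log (m / β) ≤ l := Nat.le_ceil _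
  have hl₁ : 1 ≤ l := Nat.ceil_pos.2 (by linarith)
  have hl₂ : (l : ℝ) ≤ 32 * Real.log (m / β) := by
    linarith [Nat.ceil_lt_add_one (a := 30 * Real.log (m / β)) (by linarith)]
  obtain ⟨A', hA', hrobust⟩ := hA.exists_isRobust_of_failure_le hobl hspace hs hη hl₁ hβ.le
    (succ_le_two_pow hm (by linarith)) <| by
      linarith [mul_mul_five_sixths_pow_le hm hβ hβ₁ hl,
        mul_responseFailure_le hβ hβ₁ hl₁ hl hη hs hms]
  refine ⟨A', ?_, hrobust⟩
  calc (A'.space : ℝ) ≤ (560000000 * (l ^ 3 * η * s ^ 2) : ℕ) := Nat.cast_le.2 hA'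
    _ = 560000000 * ((l : ℝ) ^ 3 * η * s ^ 2) := by push_cast; ring
    _ ≤ 560000000 * ((32 * Real.log (m / β)) ^ 3 * η * s ^ 2) := by gcongr
    _ = 560000000 * 32 ^ 3 * (η * (s : ℝ) ^ 2 * Real.log (m / β) ^ 3) := by ring

end SegmentedAlgorithm

theorem ite_log_pow_three_le {C α β : ℝ} {m η s : ℕ} (hC : 0 ≤ C) (hm : 1 ≤ m) (hα : 0 < α)
    (hβ : 0 < β) (hβ₁ : β ≤ 1) :
    (if 1 ≤ α then 0 else C * (η * (s : ℝ) ^ 2 * Real.log (m / β) ^ 3)) ≤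
      C * (η * (s : ℝ) ^ 2 * Real.log (m / β) * Real.log (m / (β * α)) ^ 2) := by
  have hm' : (1 : ℝ) ≤ m := by exact_mod_cast hm
  have hlog : 0 ≤ Real.log (m / β) := Real.log_nonneg ((one_le_div hβ).2 (hβ₁.trans hm'))
  split_ifs with hα₁
  · positivity
  · have hlogα : Real.log (m / β) ≤ Real.log (m / (β * α)) := by
      refine Real.log_le_log (by positivity) ?_
      gcongr
      exact mul_le_of_le_one_right hβ.le (not_le.1 hα₁).le
    rw [pow_succ' _ 2, ← mul_assoc (η * (s : ℝ) ^ 2)]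
    gcongr

end Streaming

open Streaming in
theorem mainTheorem1_general (c : ℕ) :
    ∃ C : ℝ, 0 < C ∧
      ∀ (X : Type*) [Fintype X] (g : List X → ℝ) (m η s : ℕ) (α β : ℝ)
        (A : SegmentedAlgorithm X),
        1 ≤ m → Fintype.card X ≤ m ^ c → 1 ≤ η → 0 < β → β < 1 →
        A.IsLinearState m → A.IsOblivious g m α (1 / 10) → A.space ≤ s →
        ∃ A' : ASAAlgorithm X,
          (A'.space : ℝ) ≤
              (if 1 ≤ α then 0 else C * (η * (s : ℝ) ^ 2 * Real.log (m / β) ^ 3)) ∧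
            ∀ T : ℕ, A'.IsRobust g m T η α β := by
  refine ⟨560000000 * 32 ^ 3 + 4 * (2 * c + 3), by positivity,
    fun X _ g m η s α β A hm hX hη hβ hβ₁ hlin hobl hspace => ?_⟩
  have hlog : 0 ≤ Real.log (m / β) :=
    Real.log_nonneg ((one_le_div hβ).2 (hβ₁.le.trans (Nat.one_le_cast.2 hm)))
  by_cases hconst : ∃ z, ∀ x : List X, x ≠ [] → x.length ≤ m → Accurate α (g x) z
  · obtain ⟨A', hA', hrobust⟩ := exists_isRobust_space_eq_zero hβ.le hconst.choose_spec
    refine ⟨A', ?_, hrobust⟩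
    rw [hA', Nat.cast_zero]
    split_ifs <;> positivity
  have hm₂ : 2 ≤ m := hm.lt_of_ne <| by
    rintro rfl
    have : Subsingleton X := Fintype.card_le_one_iff_subsingleton.1 (hX.trans_eq (one_pow c))
    exact hconst (hobl.exists_const_accurate_of_subsingleton (by norm_num) (by norm_num))
  have hs : 1 ≤ s := hspace.trans' <| Nat.one_le_iff_ne_zero.2 fun h =>
    hconst (hobl.exists_const_accurate_of_space_eq_zero (by norm_num) (by norm_num) h)
  rw [if_neg fun hα => hconst ⟨0, fun x _ _ => accurate_zero_of_one_le hα (g x)⟩]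
  rcases le_total m (η * s ^ 2) with hms | hms
  · obtain ⟨A', hA', hrobust⟩ := hobl.exists_isRobust_space_le (by norm_num) (by norm_num)
      hm₂ hX hms hβ hβ₁.le
    exact ⟨A', hA'.trans (by gcongr; norm_num), hrobust⟩
  · obtain ⟨A', hA', hrobust⟩ :=
      hlin.exists_isRobust_space_le hobl hspace hs hη hm₂ hms hβ hβ₁.le
    exact ⟨A', hA'.trans (by gcongr; linarith), hrobust⟩

theorem mainTheorem1 (c : ℕ) :
    ∃ C : ℝ, 0 < C ∧
      ∀ (X : Type*) [Fintype X] (g : List X → ℝ) (m η s : ℕ) (α β : ℝ)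
        (A : Streaming.SegmentedAlgorithm X),
        1 ≤ m → Fintype.card X ≤ m ^ c → 1 ≤ η → 0 < α → 0 < β → β < 1 →
        A.IsLinearState m → A.IsOblivious g m α (1 / 10) → A.space ≤ s →
        ∃ A' : Streaming.ASAAlgorithm X,
          (A'.space : ℝ) ≤
              C * (η * (s : ℝ) ^ 2 * Real.log (m / β) * Real.log (m / (β * α)) ^ 2) ∧
            ∀ T : ℕ, A'.IsRobust g m T η α β := by
  obtain ⟨C, hC, h⟩ := mainTheorem1_general c
  exact ⟨C, hC, fun X _ g m η s α β A hm hX hη hα hβ hβ₁ hlin hobl hspace =>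
    (h X g m η s α β A hm hX hη hβ hβ₁ hlin hobl hspace).imp fun _ => And.imp_left
      (le_trans · (Streaming.ite_log_pow_three_le hC.le hm hα hβ hβ₁.le))⟩
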